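/- Let $((y_{m,n})_{n\in\mathbb Z})_{m\ge 1}$ be mutually independent scalar time series on a probability space, each zero-mean, stationary and complex Gaussian: every finite complex linear combination $x$ of the $(y_{m,n})_{n\in\mathbb Z}$ is $\mathcal N_{\mathbb C}(0,\sigma^2)$ for some $\sigma^2\ge 0$, i.e. $\mathrm{Re}\,x$ and $\mathrm{Im}\,x$ are independent and $\mathcal N(0,\sigma^2/2)$. Let $r_{m,u}=\mathbb E[y_{m,n+u}\,\overline{y_{m,n}}]$ and let $s_m(\nu)=\sum_{u\in\mathbb Z} r_{m,u}e^{-2i\pi u\nu}$ be the spectral density of the $m$-th series. Assume $$\inf_{m\ge1}\inf_{\nu\in[0,1]}|s_m(\nu)|>0,\qquad \sup_{m\ge 1}\sum_{u\in\mathbb Z}(1+|u|)^{\gamma_0}|r_{m,u}|<\infty\quad\text{for some }\gamma_0\ge 3 .$$ Let $M=M(N)$ and $B=B(N)$ be nonnegative integers, $B$ even, such that $B,M=\mathcal O(N^\alpha)$ for some $\alpha\in(\tfrac12,1)$ and $\frac{M}{B+1}\to c\in(0,1)$ as $N\to\infty$. Put $\xi_{y_m}(\nu)=\frac1{\sqrt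 N}\sum_{n=1}^N y_{m,n}e^{-2i\pi(n-1)\nu}$, $\boldsymbol\xi(\nu)=(\xi_{y_1}(\nu),\dots,\xi_{y_M}(\nu))^T$, $$\hat S_N(\nu)=\frac1{B+1}\sum_{b=-B/2}^{B/2}\boldsymbol\xi\!\left(\nu+\tfrac bN\right)\boldsymbol\xi\!\left(\nu+\tfrac bN\right)^*,\qquad S_N(\nu)=\mathrm{diag}(s_1(\nu),\dots,s_M(\nu)),$$ $$\hat C_N(\nu)=\mathrm{diag}(\hat S_N(\nu))^{-1/2}\,\hat S_N(\nu)\,\mathrm{diag}(\hat S_N(\nu))^{-1/2},\qquad \tilde C_N(\nu)=S_N(\nu)^{-1/2}\,\hat S_N(\nu)\,S_N(\nu)^{-1/2}.$$ For families of nonnegative random variables $X^{(N)}(\nu),Y^{(N)}(\nu)$, $\nu\in[0,1]$, write $X\prec Y$ if for every $\epsilon>0$ there are $\gamma>0$ and $N_0$, independent of $\nu$, such that $\mathbb P[X^{(N)}(\nu)>N^\epsilon Y^{(N)}(\nu)]\le e^{-N^\gamma}$ for all $N\ge N_0$ and all $\nu\in[0,1]$. Let $\|\cdot\|$ be the spectral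 norm. Then for every $N$ and every $\nu\in[0,1]$ there exist, on the same probability space, an $M\times(B+1)$ random matrix $X_N(\nu)$ with i.i.d. $\mathcal N_{\mathbb C}(0,1)$ entries and $M\times M$ random matrices $\tilde\Delta_N(\nu)$, $\Delta_N(\nu)$ such that $$\tilde C_N(\nu)=\frac{X_N(\nu)X_N(\nu)^*}{B+1}+\tilde\Delta_N(\nu),\qquad \|\tilde\Delta_N(\nu)\|\prec\frac BN,$$ $$\hat C_N(\nu)=\frac{X_N(\nu)X_N(\nu)^*}{B+1}+\Delta_N(\nu),\qquad \|\Delta_N(\nu)\|\prec\frac1{\sqrt B}+\frac BN .$$ -/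

import Mathlib

open MeasureTheory ProbabilityTheory Filter Topology
open scoped NNReal Matrix ComplexConjugate

noncomputable section

namespace Coherency

/-- `Z` is `𝒩_ℂ(0, v)` distributed: its real and imaginary parts are independent and both
`𝒩(0, v / 2)` distributed (`v = 0` is allowed). -/
def IsComplexGaussian {Ω : Type*} [MeasurableSpace Ω] (μ : Measure Ω) (Z : Ω → ℂ) (v : ℝ≥0) :
    Prop :=
  HasLaw (fun ω => (Z ω).re) (gaussianReal 0 (v / 2)) μ ∧
  HasLaw (fun ω => (Z ω).im) (gaussianReal 0 (v / 2)) μ ∧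
  IndepFun (fun ω => (Z ω).re) (fun ω => (Z ω).im) μ

/-- The autocovariance sequence `r_u = 𝔼[y_u y_0^*]` of a scalar stationary time series. -/
def autocov {Ω : Type*} [MeasurableSpace Ω] (μ : Measure Ω) (y : ℤ → Ω → ℂ) (u : ℤ) : ℂ :=
  ∫ ω, y u ω * conj (y 0 ω) ∂μ

/-- A scalar zero-mean stationary complex Gaussian time series: every finite complex linear
combination of its entries is complex Gaussian.  Stationarity is expressed on covariances, which
determine the law of such a series. -/
structure IsStationaryComplexGaussian {Ω : Type*} [MeasurableSpace Ω] (μ : Measure Ω)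
    (y : ℤ → Ω → ℂ) : Prop where
  measurable : ∀ n, Measurable (y n)
  mean_zero : ∀ n, ∫ ω, y n ω ∂μ = 0
  gaussian : ∀ (s : Finset ℤ) (a : ℤ → ℂ),
    ∃ v : ℝ≥0, IsComplexGaussian μ (fun ω => ∑ n ∈ s, a n * y n ω) v
  stationary : ∀ n u : ℤ, ∫ ω, y (n + u) ω * conj (y n ω) ∂μ = autocov μ y u

/-- The spectral density `s(ν) = ∑_u r_u e^{-2 i π u ν}`, for an absolutely summable
autocovariance sequence. The sum is then real because `r_{-u}` is the conjugate of `r_u`. -/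
def spectralDensity {Ω : Type*} [MeasurableSpace Ω] (μ : Measure Ω) (y : ℤ → Ω → ℂ) (ν : ℝ) : ℝ :=
  (∑' u : ℤ, autocov μ y u * Complex.exp (-2 * Complex.I * Real.pi * u * ν)).re

/-- The renormalized Fourier transform
`ξ_y(ν) = N^{-1/2} ∑_{n=1}^N y_n e^{-2 i π (n-1) ν}` of `y_1, …, y_N`. -/
def xi {Ω : Type*} (y : ℤ → Ω → ℂ) (N : ℕ) (ν : ℝ) (ω : Ω) : ℂ :=
  (1 / (Real.sqrt N : ℂ)) *
    ∑ n ∈ Finset.Icc 1 N, y n ω * Complex.exp (-2 * Complex.I * Real.pi * ((n : ℂ) - 1) * ν)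

/-- The frequency smoothed periodogram `Ŝ(ν)`, of size `M × M`, with smoothing span `B` (even),
of the first `M` series of the family `y`. -/
def smoothedPeriodogram {Ω : Type*} (y : ℕ → ℤ → Ω → ℂ) (N M B : ℕ) (ν : ℝ) (ω : Ω) :
    Matrix (Fin M) (Fin M) ℂ :=
  (1 / ((B : ℂ) + 1)) • ∑ b ∈ Finset.Icc (-((B : ℤ) / 2)) ((B : ℤ) / 2),
    Matrix.vecMulVec (fun i : Fin M => xi (y i) N (ν + (b : ℝ) / N) ω)
      (fun j : Fin M => conj (xi (y j) N (ν + (b : ℝ) / N) ω))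

/-- `diag(A)^{-1/2}`, for a matrix `A` with positive diagonal entries. -/
def invSqrtDiag {M : ℕ} (A : Matrix (Fin M) (Fin M) ℂ) : Matrix (Fin M) (Fin M) ℂ :=
  Matrix.diagonal (fun i => (((Real.sqrt (A i i).re)⁻¹ : ℝ) : ℂ))

/-- `S(ν) = diag(s_1(ν), …, s_M(ν))`. -/
def spectralMatrix {Ω : Type*} [MeasurableSpace Ω] (μ : Measure Ω) (y : ℕ → ℤ → Ω → ℂ)
    (M : ℕ) (ν : ℝ) : Matrix (Fin M) (Fin M) ℂ :=
  Matrix.diagonal (fun i : Fin M => (spectralDensity μ (y i) ν : ℂ))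

/-- The sample spectral coherency matrix `Ĉ(ν) = diag(Ŝ(ν))^{-1/2} Ŝ(ν) diag(Ŝ(ν))^{-1/2}`. -/
def coherencyHat {Ω : Type*} (y : ℕ → ℤ → Ω → ℂ) (N M B : ℕ) (ν : ℝ) (ω : Ω) :
    Matrix (Fin M) (Fin M) ℂ :=
  invSqrtDiag (smoothedPeriodogram y N M B ν ω) * smoothedPeriodogram y N M B ν ω *
    invSqrtDiag (smoothedPeriodogram y N M B ν ω)

/-- The modified matrix `C̃(ν) = diag(S(ν))^{-1/2} Ŝ(ν) diag(S(ν))^{-1/2}`. -/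
def coherencyTilde {Ω : Type*} [MeasurableSpace Ω] (μ : Measure Ω) (y : ℕ → ℤ → Ω → ℂ)
    (N M B : ℕ) (ν : ℝ) (ω : Ω) : Matrix (Fin M) (Fin M) ℂ :=
  invSqrtDiag (spectralMatrix μ y M ν) * smoothedPeriodogram y N M B ν ω *
    invSqrtDiag (spectralMatrix μ y M ν)

/-- The spectral norm of a square matrix: the operator norm for the Euclidean norm. -/
def specNorm {M : ℕ} (A : Matrix (Fin M) (Fin M) ℂ) : ℝ :=
  ‖Matrix.toEuclideanCLM (n := Fin M) (𝕜 := ℂ) A‖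

/-- Stochastic domination `X ≺ Y` of families indexed by `N` and `u ∈ U N`, with exponential
probability bounds, uniform in `u`. -/
def StochDom {Ω : Type*} [MeasurableSpace Ω] (μ : Measure Ω) {U : ℕ → Type*}
    (X Y : (N : ℕ) → U N → Ω → ℝ) : Prop :=
  ∀ ε : ℝ, 0 < ε → ∃ γ : ℝ, 0 < γ ∧ ∃ N₀ : ℕ, ∀ N : ℕ, N₀ ≤ N → ∀ u : U N,
    μ.real {ω | (N : ℝ) ^ ε * Y N u ω < X N u ω} ≤ Real.exp (-((N : ℝ) ^ γ))

/-- A random matrix with i.i.d. `𝒩_ℂ(0, 1)` entries. -/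
def IsStdComplexGaussianMatrix {Ω : Type*} [MeasurableSpace Ω] (μ : Measure Ω) {p q : ℕ}
    (X : Ω → Matrix (Fin p) (Fin q) ℂ) : Prop :=
  (∀ i j, Measurable (fun ω => X ω i j)) ∧
  (∀ i j, IsComplexGaussian μ (fun ω => X ω i j) 1) ∧
  iIndepFun (fun (k : Fin p × Fin q) (ω : Ω) => X ω k.1 k.2) μ

end Coherency

end

/-!
The rows of the problem are decoupled. For the `m`-th series, the normalized Fourier transforms
`ζ_b = ξ(ν + b / N) / √s(ν)`, `|b| ≤ B / 2`, are the coordinates of a complex Gaussian vector. Their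
covariance matrix `G` is within `O(B / N)` of the identity in operator norm: the correlation of two
of them is the value of a truncated Fourier series, where the lag `u` is missing at most `|u|` times
out of `N`, so each entry is off by `O(1 / N)`, and the spectral density is Lipschitz
(`IsStationaryComplexGaussian.norm_covMatrix_normalizedRow_sub_one_le`). Both facts use only
`∑ (1 + |u|) |r_u| < ∞`.

Hence `G = H²` with `H` Hermitian, invertible and within `O(B / N)` of the identity, and `X = H⁻¹ ζ`
is a standard complex Gaussian vector with `ζ = X + (H - 1) X`
(`IsStationaryComplexGaussian.exists_whitening`). Over all rows, this gives `Z = X + R`, with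
`C̃ = Z Zᴴ / (B + 1)`, with `X` standard, and with `R` having independent Gaussian rows of relative
size `O(B / N)`. When `N` is too small for `G` to be close to the identity, `X` is built in the same
way from a longer window, and no bound is needed.

A net of the unit ball of `ℂ^(B + 1)` and a Chernoff bound for sums of squares control `‖X‖` and
`‖R‖` (`HasIndepStdRows.measure_opNorm_le`), so that `‖X‖ ≤ τ √(B + 1)` and
`‖R‖ ≤ O(B / N) τ √(B + 1)` outside an event of probability exponentially small in `τ = N ^ e`.
Expanding `(X + R) (X + R)ᴴ` gives the bound on `C̃ - X Xᴴ / (B + 1)`.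

For `Ĉ`, a Chernoff bound shows that the diagonal of `C̃` is within `O(τ² (1 / √B + B / N))` of `1`,
and `Ĉ` is obtained from `C̃` by normalizing its diagonal, with a relative error of the same order
(`norm_invSqrtDiag_conj_sub_le`). This requires that order to be small, which may fail because `B`
may stay bounded. In that case `B` is at most a power of `τ`, and the bound `‖Ĉ‖ ≤ M ≤ B + 1`, which
holds because the entries of `Ĉ` are at most `1`, is good enough
(`IsTame.norm_renormalized_sub_le`).
-/

noncomputable section

namespace Coherency

/-! ### Operator norms, square roots and nets -/

section

open scoped Matrix.Norms.L2Operator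

theorem specNorm_eq_norm {M : ℕ} (A : Matrix (Fin M) (Fin M) ℂ) : specNorm A = ‖A‖ := rfl

theorem norm_toLp_mulVec_le {p q : ℕ} (A : Matrix (Fin p) (Fin q) ℂ) (u : Fin q → ℂ) :
    ‖WithLp.toLp 2 (A *ᵥ u)‖ ≤ ‖A‖ * ‖WithLp.toLp 2 u‖ :=
  A.l2_opNorm_mulVec (WithLp.toLp 2 u)

theorem l2_opNorm_le_of_mulVec {p q : ℕ} (A : Matrix (Fin p) (Fin q) ℂ) {C : ℝ} (hC : 0 ≤ C)
    (h : ∀ u : Fin q → ℂ, ‖WithLp.toLp 2 (A *ᵥ u)‖ ≤ C * ‖WithLp.toLp 2 u‖) : ‖A‖ ≤ C := by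
  rw [Matrix.l2_opNorm_def]
  refine ContinuousLinearMap.opNorm_le_bound _ hC fun x => ?_
  exact h x.ofLp

/-- A self-adjoint element within `δ < 1` of `1` has a self-adjoint invertible square root which is
within `δ` of `1`, because `|√x - 1| ≤ |x - 1|` on its spectrum. -/
theorem exists_sqrt_near_one {A : Type*} [CStarAlgebra A] {a : A} (ha : IsSelfAdjoint a) {δ : ℝ}
    (hδ : ‖a - 1‖ ≤ δ) (hδ1 : δ < 1) :
    ∃ b : A, IsSelfAdjoint b ∧ b * b = a ∧ IsUnit b ∧ ‖b - 1‖ ≤ δ := by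
  have hδ0 : 0 ≤ δ := (norm_nonneg _).trans hδ
  have hspec : ∀ x ∈ spectrum ℝ a, |x - 1| ≤ δ := by
    intro x hx
    have h1 : cfc (fun x : ℝ => x - 1) a = a - 1 := by
      rw [cfc_sub (fun x : ℝ => x) (fun _ => 1) a, cfc_id' ℝ a, cfc_const_one ℝ a]
    have := norm_apply_le_norm_cfc (fun x : ℝ => x - 1) a hx
    rw [h1, Real.norm_eq_abs] at this
    exact this.trans hδ
  have hpos : ∀ x ∈ spectrum ℝ a, 0 < x := fun x hx => by
    have := (abs_le.1 (hspec x hx)).1; linarith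
  have hbb : cfc Real.sqrt a * cfc Real.sqrt a = a := by
    rw [← cfc_mul Real.sqrt Real.sqrt a]
    conv_rhs => rw [← cfc_id' ℝ a]
    exact cfc_congr fun x hx => Real.mul_self_sqrt (hpos x hx).le
  refine ⟨cfc Real.sqrt a, cfc_predicate _ a, hbb, ?_, ?_⟩
  · have hu : IsUnit a := by
      have := isUnit_one_sub_of_norm_lt_one (x := 1 - a) (by rw [norm_sub_rev]; linarith)
      simpa using this
    rw [← hbb] at hu
    exact ((Commute.refl _).isUnit_mul_iff.1 hu).1
  · have h1 : cfc (fun x : ℝ => Real.sqrt x - 1) a = cfc Real.sqrt a - 1 := by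
      rw [cfc_sub Real.sqrt (fun _ => 1) a, cfc_const_one ℝ a]
    rw [← h1]
    refine norm_cfc_le hδ0 fun x hx => ?_
    refine le_trans ?_ (hspec x hx)
    have h2 : x - 1 = (√x - 1) * (√x + 1) := by
      have := Real.mul_self_sqrt (hpos x hx).le
      nlinarith
    rw [h2, abs_mul, Real.norm_eq_abs]
    refine le_mul_of_one_le_right (abs_nonneg _) ?_
    rw [abs_of_nonneg (by positivity)]
    linarith [Real.sqrt_nonneg x]

/-- A maximal `1`-separated subset of the ball of radius `2`, scaled by `1 / 2`, is a `1 / 2`-net of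
the unit ball; its cardinality is bounded by a volume argument. -/
theorem exists_half_net (E : Type*) [NormedAddCommGroup E] [NormedSpace ℝ E]
    [FiniteDimensional ℝ E] :
    ∃ s : Finset E, s.card ≤ 5 ^ Module.finrank ℝ E ∧ (∀ c ∈ s, ‖c‖ ≤ 1) ∧
      ∀ v : E, ‖v‖ ≤ 1 → ∃ c ∈ s, ‖v - c‖ ≤ 1 / 2 := by
  classical
  let P : Finset E → Prop := fun s => (∀ c ∈ s, ‖c‖ ≤ 2) ∧
    ∀ c ∈ s, ∀ d ∈ s, c ≠ d → 1 ≤ ‖c - d‖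
  have hcard : ∀ s, P s → s.card ≤ 5 ^ Module.finrank ℝ E := fun s hs =>
    Besicovitch.card_le_of_separated s hs.1 hs.2
  obtain ⟨s, hs, hmax⟩ : ∃ s, P s ∧ ∀ s', P s' → s'.card ≤ s.card := by
    have hne : {n | ∃ s, P s ∧ s.card = n}.Nonempty := ⟨0, ∅, by simp [P], rfl⟩
    have hbdd : BddAbove {n | ∃ s, P s ∧ s.card = n} :=
      ⟨_, by rintro n ⟨s, hs, rfl⟩; exact hcard s hs⟩
    obtain ⟨s, hs, hsc⟩ := Nat.sSup_mem hne hbdd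
    exact ⟨s, hs, fun s' hs' => hsc ▸ le_csSup hbdd ⟨s', hs', rfl⟩⟩
  refine ⟨s.image fun c => (1 / 2 : ℝ) • c, Finset.card_image_le.trans (hcard s hs), ?_, ?_⟩
  · intro c hc
    obtain ⟨d, hd, rfl⟩ := Finset.mem_image.1 hc
    rw [norm_smul]
    have := hs.1 d hd
    norm_num
    linarith
  · intro v hv
    -- maximality: twice `v` cannot be added to the separated set
    obtain ⟨c, hc, hvc⟩ : ∃ c ∈ s, ‖(2 : ℝ) • v - c‖ ≤ 1 := by
      by_contra! hcon
      have hnot : (2 : ℝ) • v ∉ s := fun h => by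
        have := hcon _ h
        simp at this
        linarith
      have hP : P (insert ((2 : ℝ) • v) s) := by
        refine ⟨fun c hc => ?_, fun c hc d hd hcd => ?_⟩
        · rcases Finset.mem_insert.1 hc with rfl | hc
          · rw [norm_smul]; norm_num; linarith
          · exact hs.1 c hc
        · rcases Finset.mem_insert.1 hc with rfl | hc
          · rcases Finset.mem_insert.1 hd with rfl | hd
            · exact absurd rfl hcd
            · exact (hcon d hd).le
          · rcases Finset.mem_insert.1 hd with rfl | hd
            · rw [norm_sub_rev]; exact (hcon c hc).le
            · exact hs.2 c hc d hd hcd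
      have := hmax _ hP
      rw [Finset.card_insert_of_notMem hnot] at this
      omega
    refine ⟨(1 / 2 : ℝ) • c, Finset.mem_image_of_mem _ hc, ?_⟩
    have : v - (1 / 2 : ℝ) • c = (1 / 2 : ℝ) • ((2 : ℝ) • v - c) := by
      rw [smul_sub, smul_smul]; norm_num
    rw [this, norm_smul]
    norm_num
    linarith

/-- The operator norm on `ℂ^q` is controlled by the values on a `1 / 2`-net of the unit ball with at
most `25 ^ q` points, since `‖A‖ ≤ ‖A‖ / 2 + max ‖A c‖`. -/
theorem exists_net_opNorm (q : ℕ) :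
    ∃ s : Finset (Fin q → ℂ), s.card ≤ 25 ^ q ∧ (∀ c ∈ s, ‖WithLp.toLp 2 c‖ ≤ 1) ∧
      ∀ (p : ℕ) (A : Matrix (Fin p) (Fin q) ℂ) (t : ℝ), 0 ≤ t →
        (∀ c ∈ s, ‖WithLp.toLp 2 (A *ᵥ c)‖ ≤ t) → ‖A‖ ≤ 2 * t := by
  classical
  obtain ⟨s, hcard, hs1, hs⟩ := exists_half_net (EuclideanSpace ℂ (Fin q))
  refine ⟨s.image fun c => c.ofLp, ?_, ?_, ?_⟩
  · refine Finset.card_image_le.trans (hcard.trans ?_)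
    -- the real dimension `2 q` gives `5 ^ (2 q) = 25 ^ q`
    have : Module.finrank ℝ (EuclideanSpace ℂ (Fin q)) = 2 * q := by
      rw [← Module.finrank_mul_finrank ℝ ℂ]; simp
    rw [this, pow_mul]
    norm_num
  · intro c hc
    obtain ⟨d, hd, rfl⟩ := Finset.mem_image.1 hc
    exact hs1 d hd
  · intro p A t ht h
    have key : ‖A‖ ≤ ‖A‖ * (1 / 2) + t := by
      rw [Matrix.l2_opNorm_def]
      set T := ((Matrix.toEuclideanLin (𝕜 := ℂ) (m := Fin p) (n := Fin q)).trans
        LinearMap.toContinuousLinearMap A)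
      refine ContinuousLinearMap.opNorm_le_of_unit_norm (𝕜 := ℂ) (by positivity) fun x hx => ?_
      obtain ⟨c, hc, hxc⟩ := hs x hx.le
      have h1 : ‖T c‖ ≤ t := h _ (Finset.mem_image_of_mem _ hc)
      calc ‖T x‖ = ‖T (x - c) + T c‖ := by simp
        _ ≤ ‖T (x - c)‖ + ‖T c‖ := norm_add_le _ _
        _ ≤ ‖T‖ * (1 / 2) + t := by
          gcongr
          exact (T.le_opNorm _).trans (by gcongr)
    linarith

end

/-! ### Complex Gaussian vectors -/

section

theorem integral_exp_mul_sq_gaussianReal (w : ℝ≥0) {l : ℝ} (hl : 2 * l * w < 1) :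
    ∫ x, Real.exp (l * x ^ 2) ∂gaussianReal 0 w = (√(1 - 2 * l * w))⁻¹ := by
  rcases eq_or_ne w 0 with rfl | hw
  · simp
  have hw' : (0 : ℝ) < w := by positivity
  have hb : 0 < 1 - 2 * l * w := by linarith
  rw [integral_gaussianReal_eq_integral_smul hw]
  have h1 : ∀ x : ℝ, gaussianPDFReal 0 w x • Real.exp (l * x ^ 2) =
      (√(2 * Real.pi * w))⁻¹ * Real.exp (-((1 - 2 * l * w) / (2 * w)) * x ^ 2) := by
    intro x
    rw [gaussianPDFReal, smul_eq_mul, mul_assoc, ← Real.exp_add]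
    congr 2
    field_simp
    ring
  simp_rw [h1]
  rw [integral_const_mul, integral_gaussian, ← Real.sqrt_inv, ← Real.sqrt_inv,
    ← Real.sqrt_mul (by positivity)]
  congr 1
  field_simp

theorem integrable_exp_mul_sq_gaussianReal (w : ℝ≥0) {l : ℝ} (hl : 2 * l * w < 1) :
    Integrable (fun x => Real.exp (l * x ^ 2)) (gaussianReal 0 w) := by
  by_contra h
  have h1 := integral_exp_mul_sq_gaussianReal w hl
  rw [integral_undef h] at h1
  have : 0 < (√(1 - 2 * l * w))⁻¹ := by
    have : 0 < 1 - 2 * l * w := by linarith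
    positivity
  linarith

variable {Ω : Type*} [MeasurableSpace Ω] {μ : Measure Ω}

section IsComplexGaussian

variable {Z : Ω → ℂ} {v : ℝ≥0}

theorem _root_.ProbabilityTheory.HasLaw.memLp_gaussianReal {X : Ω → ℝ} {w : ℝ≥0}
    (h : HasLaw X (gaussianReal 0 w) μ) : MemLp X 2 μ := by
  have := memLp_id_gaussianReal' (μ := 0) (v := w) 2 (by simp)
  rw [← h.map_eq, memLp_map_measure_iff aestronglyMeasurable_id h.aemeasurable] at this
  exact this

theorem _root_.ProbabilityTheory.HasLaw.integral_sq_gaussianReal {X : Ω → ℝ} {w : ℝ≥0}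
    (h : HasLaw X (gaussianReal 0 w) μ) : ∫ ω, X ω ^ 2 ∂μ = w := by
  have h1 : ∫ ω, X ω ^ 2 ∂μ = ∫ x, x ^ 2 ∂gaussianReal 0 w :=
    h.integral_comp (f := fun x : ℝ => x ^ 2) (by fun_prop)
  rw [h1, ← variance_fun_id_gaussianReal (μ := 0) (v := w),
    variance_of_integral_eq_zero (by fun_prop) (integral_id_gaussianReal)]

theorem IsComplexGaussian.aemeasurable (h : IsComplexGaussian μ Z v) : AEMeasurable Z μ := by
  have h1 := Complex.measurable_ofReal.comp_aemeasurable h.1.aemeasurable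
  have h2 := Complex.measurable_ofReal.comp_aemeasurable h.2.1.aemeasurable
  refine (h1.add (h2.mul_const Complex.I)).congr (Eventually.of_forall fun ω => ?_)
  simp [Complex.re_add_im]

theorem IsComplexGaussian.memLp (h : IsComplexGaussian μ Z v) : MemLp Z 2 μ :=
  memLp_re_im_iff.1 ⟨h.1.memLp_gaussianReal, h.2.1.memLp_gaussianReal⟩

theorem IsComplexGaussian.integral_norm_sq (h : IsComplexGaussian μ Z v) :
    ∫ ω, ‖Z ω‖ ^ 2 ∂μ = v := by
  have h1 : ∀ ω, ‖Z ω‖ ^ 2 = (Z ω).re ^ 2 + (Z ω).im ^ 2 := fun ω => by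
    rw [← Complex.normSq_eq_norm_sq, Complex.normSq_apply]; ring
  simp_rw [h1]
  rw [integral_add h.1.memLp_gaussianReal.integrable_sq h.2.1.memLp_gaussianReal.integrable_sq,
    h.1.integral_sq_gaussianReal, h.2.1.integral_sq_gaussianReal]
  push_cast
  ring

/-- The characteristic function of the real part at `1`; applied to all linear forms of a vector, it
determines the law of the vector. -/
theorem IsComplexGaussian.integral_cexp_re (h : IsComplexGaussian μ Z v) :
    ∫ ω, Complex.exp ((Z ω).re * Complex.I) ∂μ = Complex.exp (-(v / 4)) := by
  have h1 : ∫ ω, Complex.exp ((Z ω).re * Complex.I) ∂μ =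
      ∫ x : ℝ, Complex.exp (x * Complex.I) ∂gaussianReal 0 (v / 2) :=
    h.1.integral_comp (f := fun x : ℝ => Complex.exp (x * Complex.I)) (by fun_prop)
  have h2 := charFun_gaussianReal (μ := 0) (v := v / 2) 1
  rw [charFun_apply_real] at h2
  simp only [Complex.ofReal_one, one_mul] at h2
  rw [h1, h2]
  congr 1
  push_cast
  ring

/-- Exponential moments of `|Z|²`. The exact value is `(1 - l v)⁻¹`; this weaker bound does not use
the independence of the real and imaginary parts. -/
theorem IsComplexGaussian.exp_mul_norm_sq_le (h : IsComplexGaussian μ Z v) {l : ℝ}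
    (hl : 2 * l * v < 1) :
    Integrable (fun ω => Real.exp (l * ‖Z ω‖ ^ 2)) μ ∧
      ∫ ω, Real.exp (l * ‖Z ω‖ ^ 2) ∂μ ≤ (√(1 - 2 * l * v))⁻¹ := by
  have hl' : 2 * (2 * l) * ((v / 2 : ℝ≥0) : ℝ) < 1 := by push_cast; linarith
  have key : ∀ X : Ω → ℝ, HasLaw X (gaussianReal 0 (v / 2)) μ →
      Integrable (fun ω => Real.exp (2 * l * X ω ^ 2)) μ ∧
      ∫ ω, Real.exp (2 * l * X ω ^ 2) ∂μ = (√(1 - 2 * l * v))⁻¹ := by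
    intro X hX
    constructor
    · have := integrable_exp_mul_sq_gaussianReal (v / 2) hl'
      rw [← hX.map_eq, integrable_map_measure (by fun_prop) hX.aemeasurable] at this
      exact this
    · have h1 : ∫ ω, Real.exp (2 * l * X ω ^ 2) ∂μ =
          ∫ x, Real.exp (2 * l * x ^ 2) ∂gaussianReal 0 (v / 2) :=
        hX.integral_comp (f := fun x : ℝ => Real.exp (2 * l * x ^ 2)) (by fun_prop)
      rw [h1, integral_exp_mul_sq_gaussianReal _ hl']
      push_cast
      congr 3
      ring
  obtain ⟨i1, e1⟩ := key _ h.1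
  obtain ⟨i2, e2⟩ := key _ h.2.1
  -- convexity of the exponential separates the real and imaginary parts
  have hconv : ∀ ω, Real.exp (l * ‖Z ω‖ ^ 2) ≤
      (Real.exp (2 * l * (Z ω).re ^ 2) + Real.exp (2 * l * (Z ω).im ^ 2)) / 2 := by
    intro ω
    have hn : l * ‖Z ω‖ ^ 2 = l * (Z ω).re ^ 2 + l * (Z ω).im ^ 2 := by
      rw [← Complex.normSq_eq_norm_sq, Complex.normSq_apply]; ring
    have e : ∀ a : ℝ, Real.exp (2 * l * a ^ 2) = Real.exp (l * a ^ 2) ^ 2 := fun a => by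
      rw [← Real.exp_nat_mul]; congr 1; push_cast; ring
    rw [hn, Real.exp_add, e, e]
    nlinarith [sq_nonneg (Real.exp (l * (Z ω).re ^ 2) - Real.exp (l * (Z ω).im ^ 2))]
  have i3 := (i1.add i2).div_const 2
  have hint : Integrable (fun ω => Real.exp (l * ‖Z ω‖ ^ 2)) μ := by
    refine i3.mono' ?_ (Eventually.of_forall fun ω => ?_)
    · have := h.aemeasurable
      exact AEMeasurable.aestronglyMeasurable (by fun_prop)
    · rw [Real.norm_eq_abs, abs_of_pos (Real.exp_pos _)]
      exact hconv ω
  refine ⟨hint, (integral_mono hint i3 hconv).trans ?_⟩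
  simp only [Pi.add_apply]
  rw [integral_div, integral_add i1 i2, e1, e2]
  linarith

end IsComplexGaussian

/-- `X` is a standard complex Gaussian vector, expressed through its linear forms: `∑ a_k X_k` is
`𝒩_ℂ(0, ∑ |a_k|²)` distributed for all `a`. -/
structure IsStdComplexGaussianVector {q : ℕ} (μ : Measure Ω) (X : Fin q → Ω → ℂ) : Prop where
  measurable : ∀ k, Measurable (X k)
  gaussian : ∀ a : Fin q → ℂ,
    IsComplexGaussian μ (fun ω => ∑ k, a k * X k ω) (∑ k, ‖a k‖₊ ^ 2)

theorem IsStdComplexGaussianVector.isComplexGaussian {q : ℕ} {X : Fin q → Ω → ℂ}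
    (h : IsStdComplexGaussianVector μ X) (k : Fin q) : IsComplexGaussian μ (X k) 1 := by
  classical
  have := h.gaussian (Pi.single k 1)
  have e1 : (fun ω => ∑ j, (Pi.single k (1 : ℂ) : Fin q → ℂ) j * X j ω) = X k := by
    ext ω
    rw [Finset.sum_eq_single k] <;> simp +contextual
  have e2 : ∑ j, ‖(Pi.single k (1 : ℂ) : Fin q → ℂ) j‖₊ ^ 2 = 1 := by
    rw [Finset.sum_eq_single k] <;> simp +contextual
  rwa [e1, e2] at this

theorem IsStdComplexGaussianVector.iIndepFun_entries [IsProbabilityMeasure μ] {q : ℕ}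
    {X : Fin q → Ω → ℂ} (h : IsStdComplexGaussianVector μ X) : iIndepFun X μ := by
  classical
  have hm := h.measurable
  rw [iIndepFun_iff_charFun_pi fun k => (hm k).aemeasurable]
  intro t
  have hin : ∀ z w : ℂ, inner ℝ z w = (conj w * z).re := fun z w => by
    rw [Complex.inner]; simp [mul_comm]
  -- both sides are characteristic functions of linear forms
  have e1 : charFun (μ.map (fun ω => WithLp.toLp 2 (X · ω))) t =
      Complex.exp (-((∑ k, ‖conj (t k)‖₊ ^ 2 : ℝ≥0) / 4)) := by
    rw [← (h.gaussian fun k => conj (t k)).integral_cexp_re, charFun_apply,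
      integral_map (by fun_prop) (by fun_prop)]
    congr 1 with ω
    congr 2
    rw [PiLp.inner_apply]
    simp only [hin, Complex.re_sum]
  have e2 : ∀ k, charFun (μ.map (X k)) (t k) = Complex.exp (-((‖conj (t k)‖₊ ^ 2 : ℝ≥0) / 4)) := by
    intro k
    have hk := h.gaussian (Pi.single k (conj (t k)))
    have f1 : (fun ω => ∑ j, (Pi.single k (conj (t k)) : Fin q → ℂ) j * X j ω) =
        fun ω => conj (t k) * X k ω := by
      ext ω
      rw [Finset.sum_eq_single k] <;> simp +contextual
    have f2 : ∑ j, ‖(Pi.single k (conj (t k)) : Fin q → ℂ) j‖₊ ^ 2 = ‖conj (t k)‖₊ ^ 2 := by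
      rw [Finset.sum_eq_single k] <;> simp +contextual
    rw [f1, f2] at hk
    rw [← hk.integral_cexp_re, charFun_apply, integral_map (hm k).aemeasurable (by fun_prop)]
    simp only [hin]
  rw [e1]
  simp_rw [e2]
  rw [← Complex.exp_sum]
  congr 1
  push_cast
  rw [Finset.sum_div, Finset.sum_neg_distrib]

/-- All linear forms of the random vector `ζ` are complex Gaussian. -/
structure IsComplexGaussianVector {q : ℕ} (μ : Measure Ω) (ζ : Fin q → Ω → ℂ) : Prop where
  measurable : ∀ k, Measurable (ζ k)
  gaussian : ∀ a : Fin q → ℂ, ∃ v, IsComplexGaussian μ (fun ω => ∑ k, a k * ζ k ω) v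

theorem IsComplexGaussianVector.memLp {q : ℕ} {ζ : Fin q → Ω → ℂ}
    (h : IsComplexGaussianVector μ ζ) (k : Fin q) : MemLp (ζ k) 2 μ := by
  classical
  obtain ⟨v, hv⟩ := h.gaussian (Pi.single k 1)
  have e1 : (fun ω => ∑ j, (Pi.single k (1 : ℂ) : Fin q → ℂ) j * ζ j ω) = ζ k := by
    ext ω
    rw [Finset.sum_eq_single k] <;> simp +contextual
  rw [e1] at hv
  exact hv.memLp

theorem _root_.MeasureTheory.MemLp.integrable_mul_conj {f g : Ω → ℂ} (hf : MemLp f 2 μ)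
    (hg : MemLp g 2 μ) : Integrable (fun ω => f ω * conj (g ω)) μ :=
  hf.integrable_mul hg.star

/-- The covariance matrix of a zero-mean complex random vector. -/
def covMatrix {q : ℕ} (μ : Measure Ω) (ζ : Fin q → Ω → ℂ) : Matrix (Fin q) (Fin q) ℂ :=
  Matrix.of fun k l => ∫ ω, ζ k ω * conj (ζ l ω) ∂μ

theorem covMatrix_isHermitian {q : ℕ} (ζ : Fin q → Ω → ℂ) : (covMatrix μ ζ).IsHermitian := by
  ext k l
  simp only [covMatrix, Matrix.conjTranspose_apply, Matrix.of_apply, RCLike.star_def]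
  rw [← integral_conj]
  congr 1 with ω
  simp [mul_comm]

theorem covMatrix_mulVec {p q : ℕ} {ζ : Fin q → Ω → ℂ} (h : ∀ k, MemLp (ζ k) 2 μ)
    (W : Matrix (Fin p) (Fin q) ℂ) :
    covMatrix μ (fun i ω => ∑ k, W i k * ζ k ω) = W * covMatrix μ ζ * Wᴴ := by
  ext i j
  simp only [covMatrix, Matrix.of_apply, Matrix.mul_apply, Matrix.conjTranspose_apply,
    RCLike.star_def, map_sum, map_mul, Finset.sum_mul_sum]
  rw [integral_finsetSum _ fun k _ => ?_]
  · rw [Finset.sum_congr rfl fun k _ => integral_finsetSum _ fun l _ => ?_]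
    · rw [Finset.sum_comm]
      refine Finset.sum_congr rfl fun l _ => ?_
      rw [Finset.sum_mul]
      refine Finset.sum_congr rfl fun k _ => ?_
      rw [← integral_const_mul, ← integral_mul_const]
      congr 1 with ω
      ring
    · refine (((h k).integrable_mul_conj (h l)).const_mul (W i k * conj (W j l))).congr
        (Eventually.of_forall fun ω => ?_)
      simp only
      ring
  · refine integrable_finsetSum _ fun l _ => ?_
    refine (((h k).integrable_mul_conj (h l)).const_mul (W i k * conj (W j l))).congr
      (Eventually.of_forall fun ω => ?_)
    simp only
    ring

theorem IsComplexGaussianVector.mulVec {p q : ℕ} {ζ : Fin q → Ω → ℂ}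
    (h : IsComplexGaussianVector μ ζ) (W : Matrix (Fin p) (Fin q) ℂ) :
    IsComplexGaussianVector μ (fun i ω => ∑ k, W i k * ζ k ω) := by
  have hm := h.measurable
  refine ⟨fun i => by fun_prop, fun a => ?_⟩
  obtain ⟨v, hv⟩ := h.gaussian (a ᵥ* W)
  refine ⟨v, ?_⟩
  convert hv using 2 with ω
  simp only [Matrix.vecMul, dotProduct, Finset.mul_sum, Finset.sum_mul]
  rw [Finset.sum_comm]
  simp only [mul_assoc]

/-- A complex Gaussian vector with identity covariance is standard: the variance of a linear form is
read off from the covariance matrix. -/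
theorem IsComplexGaussianVector.isStd {q : ℕ} {ζ : Fin q → Ω → ℂ}
    (h : IsComplexGaussianVector μ ζ) (hcov : covMatrix μ ζ = 1) :
    IsStdComplexGaussianVector μ ζ := by
  refine ⟨h.measurable, fun a => ?_⟩
  obtain ⟨v, hv⟩ := h.gaussian a
  suffices hva : v = ∑ k, ‖a k‖₊ ^ 2 by rwa [← hva]
  have hM := covMatrix_mulVec h.memLp (Matrix.of fun _ : Fin 1 => a)
  rw [hcov, Matrix.mul_one] at hM
  have h1 := congrFun (congrFun hM 0) 0
  simp only [covMatrix, Matrix.of_apply, Complex.mul_conj'] at h1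
  rw [integral_congr_ae (g := fun ω => ((‖∑ k, a k * ζ k ω‖ ^ 2 : ℝ) : ℂ))
    (Eventually.of_forall fun ω => by simp), integral_complex_ofReal, hv.integral_norm_sq] at h1
  simp only [Matrix.mul_apply, Matrix.of_apply, Matrix.conjTranspose_apply, RCLike.star_def,
    Complex.mul_conj'] at h1
  rw [← NNReal.coe_inj]
  push_cast
  exact_mod_cast h1

end

/-! ### Concentration for matrices with independent Gaussian rows -/

section

open scoped Matrix.Norms.L2Operator

/-- The bound making `‖X k‖ ^ 2 - 1` sub-exponential, for a standard complex Gaussian `X k`. -/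
theorem inv_sqrt_one_sub_le {l : ℝ} (hl : |l| ≤ 1 / 10) :
    (√(1 - 2 * l))⁻¹ ≤ Real.exp (l + 4 * l ^ 2) := by
  obtain ⟨h1, h2⟩ := abs_le.1 hl
  set y : ℝ := -(2 * l) - 2 * (2 * l) ^ 2 with hy
  have hexp : Real.exp y ≤ 1 - 2 * l := by
    have hy1 : |y| ≤ 1 := by rw [abs_le]; constructor <;> nlinarith
    have h3 := (abs_le.1 (Real.norm_exp_sub_one_sub_id_le (x := y) (by simpa using hy1))).2
    rw [Real.norm_eq_abs, sq_abs] at h3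
    have e : y ^ 2 = (2 * l) ^ 2 * (1 + 2 * (2 * l)) ^ 2 := by rw [hy]; ring
    have h4 : (1 + 2 * (2 * l)) ^ 2 ≤ 2 := by nlinarith
    have h5 := mul_le_mul_of_nonneg_left h4 (sq_nonneg (2 * l))
    linarith
  have hs : Real.exp (-(l + 4 * l ^ 2)) ≤ √(1 - 2 * l) := by
    refine Real.le_sqrt_of_sq_le (le_trans (le_of_eq ?_) hexp)
    rw [← Real.exp_nat_mul]
    congr 1
    rw [hy]; push_cast; ring
  rw [Real.exp_neg] at hs
  exact inv_le_of_inv_le₀ (Real.exp_pos _) hs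

variable {Ω : Type*} [MeasurableSpace Ω] {μ : Measure Ω} [IsProbabilityMeasure μ]

/-- Chernoff bound, in both directions, for the squared norm of a standard vector. The parameter
`1 / (10 √q)` gives an exponential tail at the scale `√q`, uniformly in `q`. -/
theorem IsStdComplexGaussianVector.measure_norm_sq_deviation_le {q : ℕ} (hq : 1 ≤ q)
    {X : Fin q → Ω → ℂ} (h : IsStdComplexGaussianVector μ X) {t : ℝ} :
    μ.real {ω | t * √q < |∑ k, ‖X k ω‖ ^ 2 - q|} ≤ 2 * Real.exp (1 / 25 - t / 10) := by
  have hm := h.measurable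
  have hq' : (1 : ℝ) ≤ q := by exact_mod_cast hq
  have hsq : 0 < √(q : ℝ) := by positivity
  have hss : √(q : ℝ) * √q = q := Real.mul_self_sqrt (by positivity)
  have hsq1 : 1 ≤ √(q : ℝ) := Real.one_le_sqrt.2 hq'
  have hmeas : ∀ k, Measurable fun ω => ‖X k ω‖ ^ 2 := fun k => by fun_prop
  have hind : iIndepFun (fun k ω => ‖X k ω‖ ^ 2) μ :=
    h.iIndepFun_entries.comp (fun _ z => ‖z‖ ^ 2) fun _ => by fun_prop
  have hmgf : ∀ l : ℝ, |l| ≤ 1 / 10 →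
      Integrable (fun ω => Real.exp (l * (∑ k, fun ω => ‖X k ω‖ ^ 2) ω)) μ ∧
      mgf (∑ k, fun ω => ‖X k ω‖ ^ 2) μ l ≤ Real.exp (q * (l + 4 * l ^ 2)) := by
    intro l hl
    have hk := fun k => (h.isComplexGaussian k).exp_mul_norm_sq_le (l := l)
      (by have := (abs_le.1 hl).2; push_cast; linarith)
    refine ⟨hind.integrable_exp_mul_sum hmeas fun k _ => (hk k).1, ?_⟩
    rw [hind.mgf_sum hmeas]
    calc ∏ k, mgf (fun ω => ‖X k ω‖ ^ 2) μ l ≤ ∏ k : Fin q, Real.exp (l + 4 * l ^ 2) := by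
          refine Finset.prod_le_prod (fun k _ => mgf_nonneg) fun k _ => ?_
          refine (hk k).2.trans ?_
          simpa using inv_sqrt_one_sub_le hl
      _ = Real.exp (q * (l + 4 * l ^ 2)) := by
          rw [Finset.prod_const, Finset.card_univ, Fintype.card_fin, ← Real.exp_nat_mul]
  have hlabs : |1 / (10 * √(q : ℝ))| ≤ 1 / 10 := by
    rw [abs_of_pos (by positivity)]
    exact one_div_le_one_div_of_le (by norm_num) (by linarith)
  have hl2 : q * (4 * (1 / (10 * √(q : ℝ))) ^ 2) = 1 / 25 := by
    rw [div_pow, mul_pow, sq √_, hss]; field_simp; norm_num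
  have up := hmgf (1 / (10 * √(q : ℝ))) hlabs
  have lo := hmgf (-(1 / (10 * √(q : ℝ)))) (by rwa [abs_neg])
  have hlt : (1 / (10 * √(q : ℝ))) * (t * √q) = t / 10 := by field_simp
  have cu := measure_ge_le_exp_mul_mgf (μ := μ) (q + t * √q) (by positivity) up.1
  have cl := measure_le_le_exp_mul_mgf (μ := μ) (q - t * √q)
    (by rw [neg_nonpos]; positivity) lo.1
  have bu : μ.real {ω | q + t * √q ≤ (∑ k, fun ω => ‖X k ω‖ ^ 2) ω} ≤
      Real.exp (1 / 25 - t / 10) := by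
    refine cu.trans ((mul_le_mul_of_nonneg_left up.2 (Real.exp_pos _).le).trans (le_of_eq ?_))
    rw [← Real.exp_add, ← hl2, ← hlt]
    congr 1
    ring
  have bl : μ.real {ω | (∑ k, fun ω => ‖X k ω‖ ^ 2) ω ≤ q - t * √q} ≤
      Real.exp (1 / 25 - t / 10) := by
    refine cl.trans ((mul_le_mul_of_nonneg_left lo.2 (Real.exp_pos _).le).trans (le_of_eq ?_))
    rw [← Real.exp_add, ← hl2, ← hlt]
    congr 1
    ring
  calc _ ≤ μ.real ({ω | q + t * √q ≤ (∑ k, fun ω => ‖X k ω‖ ^ 2) ω} ∪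
        {ω | (∑ k, fun ω => ‖X k ω‖ ^ 2) ω ≤ q - t * √q}) := by
        refine measureReal_mono fun ω hω => ?_
        simp only [Set.mem_ofPred_eq, lt_abs] at hω
        rcases hω with hω | hω
        · left
          simp only [Set.mem_ofPred_eq, Finset.sum_apply]
          linarith
        · right
          simp only [Set.mem_ofPred_eq, Finset.sum_apply]
          linarith
    _ ≤ _ := (measureReal_union_le _ _).trans (by linarith)

/-- A random matrix, given by its entries, whose rows are independent standard complex Gaussian
vectors. -/
structure HasIndepStdRows {p q : ℕ} (μ : Measure Ω) (X : Fin p → Fin q → Ω → ℂ) : Prop where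
  std : ∀ i, IsStdComplexGaussianVector μ (X i)
  indep : iIndepFun (fun i ω k => X i k ω) μ

theorem HasIndepStdRows.isStdComplexGaussianMatrix {p q : ℕ} {X : Fin p → Fin q → Ω → ℂ}
    (h : HasIndepStdRows μ X) :
    IsStdComplexGaussianMatrix μ (fun ω => Matrix.of fun i k => X i k ω) :=
  ⟨fun i j => (h.std i).measurable j, fun i j => (h.std i).isComplexGaussian j,
    iIndepFun_uncurry' (fun i j => (h.std i).measurable j) h.indep fun i => (h.std i).iIndepFun_entries⟩

theorem HasIndepStdRows.measure_sum_norm_sq_le {p q : ℕ} {X : Fin p → Fin q → Ω → ℂ}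
    (h : HasIndepStdRows μ X) (a : Fin p → Fin q → ℂ) (ha : ∀ i, ∑ k, ‖a i k‖ ^ 2 ≤ 1) (t : ℝ) :
    μ.real {ω | t ≤ ∑ i, ‖∑ k, a i k * X i k ω‖ ^ 2} ≤ 2 ^ p * Real.exp (-(t / 4)) := by
  have hm := fun i => (h.std i).measurable
  have hmeas : ∀ i, Measurable fun ω => ‖∑ k, a i k * X i k ω‖ ^ 2 := fun i => by fun_prop
  have hind : iIndepFun (fun i ω => ‖∑ k, a i k * X i k ω‖ ^ 2) μ :=
    h.indep.comp (fun i x => ‖∑ k, a i k * x k‖ ^ 2) fun i => by fun_prop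
  have hi : ∀ i, Integrable (fun ω => Real.exp (1 / 4 * ‖∑ k, a i k * X i k ω‖ ^ 2)) μ ∧
      mgf (fun ω => ‖∑ k, a i k * X i k ω‖ ^ 2) μ (1 / 4) ≤ 2 := by
    intro i
    have hv : ((∑ k, ‖a i k‖₊ ^ 2 : ℝ≥0) : ℝ) ≤ 1 := by push_cast; exact ha i
    obtain ⟨h1, h2⟩ := ((h.std i).gaussian (a i)).exp_mul_norm_sq_le (l := 1 / 4) (by linarith)
    refine ⟨h1, h2.trans ?_⟩
    have : (1 / 2 : ℝ) ≤ √(1 - 2 * (1 / 4) * (∑ k, ‖a i k‖₊ ^ 2 : ℝ≥0)) :=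
      Real.le_sqrt_of_sq_le (by linarith)
    exact inv_le_of_inv_le₀ (by norm_num) (by linarith)
  have hc := measure_ge_le_exp_mul_mgf (μ := μ) t (by norm_num : (0 : ℝ) ≤ 1 / 4)
    (hind.integrable_exp_mul_sum (s := Finset.univ) hmeas fun i _ => (hi i).1)
  rw [hind.mgf_sum hmeas] at hc
  have hp : ∏ i, mgf (fun ω => ‖∑ k, a i k * X i k ω‖ ^ 2) μ (1 / 4) ≤ 2 ^ p := by
    calc _ ≤ ∏ i : Fin p, (2 : ℝ) :=
          Finset.prod_le_prod (fun k _ => mgf_nonneg) fun i _ => (hi i).2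
      _ = 2 ^ p := by simp
  simp only [Finset.sum_apply] at hc
  refine hc.trans ((mul_le_mul_of_nonneg_left hp (Real.exp_pos _).le).trans (le_of_eq ?_))
  rw [mul_comm]
  congr 2
  ring

theorem norm_transpose_le {p q : ℕ} (F : Matrix (Fin p) (Fin q) ℂ) : ‖Fᵀ‖ ≤ ‖F‖ := by
  rw [← Matrix.l2_opNorm_conjTranspose F]
  refine l2_opNorm_le_of_mulVec _ (norm_nonneg _) fun u => ?_
  have h1 : Fᵀ *ᵥ u = star (Fᴴ *ᵥ star u) := by
    ext i
    simp [Matrix.mulVec, dotProduct]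
  have hstar : ∀ (n : ℕ) (v : Fin n → ℂ), ‖WithLp.toLp 2 (star v)‖ = ‖WithLp.toLp 2 v‖ := by
    intro n v
    simp [EuclideanSpace.norm_eq]
  rw [h1, hstar, ← hstar _ u]
  exact norm_toLp_mulVec_le _ _

/-- The operator norm of a matrix with independent Gaussian rows `F i (X i)`: a net of the unit
ball reduces it to finitely many linear forms in each row. -/
theorem HasIndepStdRows.measure_opNorm_le {p q : ℕ} (hq : 1 ≤ q) (hpq : p ≤ q)
    {X : Fin p → Fin q → Ω → ℂ} (h : HasIndepStdRows μ X)
    (F : Fin p → Matrix (Fin q) (Fin q) ℂ) {δ : ℝ} (hδ : 0 < δ) (hF : ∀ i, ‖F i‖ ≤ δ)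
    {t : ℝ} (ht : 8 ≤ t) :
    μ.real {ω | δ * t * √q <
      ‖(Matrix.of fun i k => ∑ l, F i k l * X i l ω : Matrix (Fin p) (Fin q) ℂ)‖} ≤
      Real.exp (4 - t ^ 2 / 16) := by
  classical
  have hq' : (1 : ℝ) ≤ q := by exact_mod_cast hq
  have hss : √(q : ℝ) ^ 2 = q := Real.sq_sqrt (by positivity)
  obtain ⟨s, hcard, hs1, hs⟩ := exists_net_opNorm q
  set a : (Fin q → ℂ) → Fin p → Fin q → ℂ := fun c i => ((δ⁻¹ : ℝ) : ℂ) • ((F i)ᵀ *ᵥ c) with ha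
  have hanorm : ∀ c ∈ s, ∀ i, ∑ k, ‖a c i k‖ ^ 2 ≤ 1 := by
    intro c hc i
    have h1 : ‖WithLp.toLp 2 ((F i)ᵀ *ᵥ c)‖ ≤ δ := by
      refine (norm_toLp_mulVec_le _ _).trans ?_
      calc _ ≤ δ * 1 := mul_le_mul ((norm_transpose_le _).trans (hF i)) (hs1 c hc)
            (norm_nonneg _) hδ.le
        _ = δ := mul_one _
    have h2 : ∑ k, ‖a c i k‖ ^ 2 = (δ⁻¹ * ‖WithLp.toLp 2 ((F i)ᵀ *ᵥ c)‖) ^ 2 := by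
      rw [mul_pow, EuclideanSpace.norm_sq_eq, Finset.mul_sum]
      refine Finset.sum_congr rfl fun k _ => ?_
      simp [ha, mul_pow]
    rw [h2]
    refine pow_le_one₀ (by positivity) ?_
    rw [inv_mul_le_iff₀ hδ]
    linarith
  have hRc : ∀ c ω, ‖WithLp.toLp 2
      ((Matrix.of fun i k => ∑ l, F i k l * X i l ω : Matrix (Fin p) (Fin q) ℂ) *ᵥ c)‖ ^ 2 =
      δ ^ 2 * ∑ i, ‖∑ k, a c i k * X i k ω‖ ^ 2 := by
    intro c ω
    rw [EuclideanSpace.norm_sq_eq, Finset.mul_sum]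
    refine Finset.sum_congr rfl fun i _ => ?_
    rw [← abs_of_pos hδ, ← Real.norm_eq_abs, ← Complex.norm_real, ← mul_pow, ← norm_mul]
    congr 2
    simp only [ha, Matrix.mulVec, dotProduct, Matrix.of_apply, Pi.smul_apply, smul_eq_mul,
      Matrix.transpose_apply, Finset.mul_sum, Finset.sum_mul]
    rw [Finset.sum_comm]
    refine Finset.sum_congr rfl fun l _ => Finset.sum_congr rfl fun k _ => ?_
    have : (δ : ℂ) ≠ 0 := by exact_mod_cast hδ.ne'
    push_cast
    field_simp
  have hsub : {ω | δ * t * √q <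
      ‖(Matrix.of fun i k => ∑ l, F i k l * X i l ω : Matrix (Fin p) (Fin q) ℂ)‖} ⊆
      ⋃ c ∈ s, {ω | t ^ 2 * q / 4 ≤ ∑ i, ‖∑ k, a c i k * X i k ω‖ ^ 2} := by
    intro ω hω
    by_contra hcon
    simp only [Set.mem_iUnion, Set.mem_ofPred_eq, not_exists, not_le] at hcon
    refine absurd (hs p _ (δ * t * √q / 2) (by positivity) fun c hc => ?_)
      (not_le.2 (lt_of_eq_of_lt (by ring) hω))
    refine abs_le_of_sq_le_sq' ?_ (by positivity) |>.2
    rw [hRc]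
    have := mul_le_mul_of_nonneg_left (hcon c hc).le (sq_nonneg δ)
    refine this.trans (le_of_eq ?_)
    rw [div_pow, mul_pow, hss]; ring
  refine (measureReal_mono hsub (measure_ne_top _ _)).trans ((measureReal_biUnion_finset_le _ _).trans ?_)
  -- the `25 ^ q` points of the net and the factor `2 ^ p` of the Chernoff bound cost `50 ^ q`
  have h50 : (50 : ℝ) ≤ Real.exp 4 := by
    have h1 := Real.exp_one_gt_d9
    have h2 : Real.exp 4 = Real.exp 1 ^ 4 := by rw [← Real.exp_nat_mul]; norm_num
    rw [h2]
    calc (50 : ℝ) ≤ 2.7 ^ 4 := by norm_num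
      _ ≤ _ := by gcongr; linarith
  calc _ ≤ ∑ c ∈ s, 2 ^ q * Real.exp (-(t ^ 2 * q / 4 / 4)) := by
        refine Finset.sum_le_sum fun c hc => ?_
        refine (h.measure_sum_norm_sq_le (a c) (hanorm c hc) _).trans ?_
        gcongr
        norm_num
    _ = s.card * (2 ^ q * Real.exp (-(t ^ 2 * q / 4 / 4))) := by rw [Finset.sum_const, nsmul_eq_mul]
    _ ≤ 25 ^ q * (2 ^ q * Real.exp (-(t ^ 2 * q / 4 / 4))) := by
        gcongr
        exact_mod_cast hcard
    _ = 50 ^ q * Real.exp (-(t ^ 2 * q / 4 / 4)) := by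
        rw [← mul_assoc, ← mul_pow]; norm_num
    _ ≤ Real.exp 4 ^ q * Real.exp (-(t ^ 2 * q / 4 / 4)) := by gcongr
    _ = Real.exp (q * (4 - t ^ 2 / 16)) := by
        rw [← Real.exp_nat_mul, ← Real.exp_add]; congr 1; ring
    _ ≤ Real.exp (4 - t ^ 2 / 16) := by
        refine Real.exp_le_exp.2 ?_
        have : 4 - t ^ 2 / 16 ≤ 0 := by nlinarith
        nlinarith

end

/-! ### Correlations of the Fourier transforms of a stationary series -/

section

open scoped Matrix.Norms.L2Operator

/-- The character `x ↦ e^{-2 i π x}` of the real line. -/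
def fourierExp (x : ℝ) : ℂ := Complex.exp ((-2 * Real.pi * x : ℝ) * Complex.I)

theorem norm_fourierExp (x : ℝ) : ‖fourierExp x‖ = 1 := Complex.norm_exp_ofReal_mul_I _

theorem fourierExp_add (x y : ℝ) : fourierExp (x + y) = fourierExp x * fourierExp y := by
  rw [fourierExp, fourierExp, fourierExp, ← Complex.exp_add]
  congr 1
  push_cast
  ring

theorem conj_fourierExp (x : ℝ) : conj (fourierExp x) = fourierExp (-x) := by
  rw [fourierExp, fourierExp, ← Complex.exp_conj, map_mul, Complex.conj_ofReal, Complex.conj_I]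
  congr 1
  push_cast
  ring

theorem fourierExp_zero : fourierExp 0 = 1 := by simp [fourierExp]

theorem fourierExp_intCast (b : ℤ) : fourierExp b = 1 := by
  rw [fourierExp, Complex.exp_eq_one_iff]
  exact ⟨-b, by push_cast; ring⟩

theorem fourierExp_eq_one_iff (x : ℝ) : fourierExp x = 1 ↔ ∃ n : ℤ, x = n := by
  refine ⟨fun h => ?_, ?_⟩
  · rw [fourierExp, Complex.exp_eq_one_iff] at h
    obtain ⟨n, hn⟩ := h
    refine ⟨-n, ?_⟩
    have h1 : (-2 * Real.pi * x : ℝ) * Complex.I = ((n * (2 * Real.pi) : ℝ) : ℂ) * Complex.I := by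
      rw [hn]; push_cast; ring
    have h2 : -2 * Real.pi * x = n * (2 * Real.pi) := by
      exact_mod_cast mul_right_cancel₀ Complex.I_ne_zero h1
    have := Real.pi_pos
    have h3 : (2 * Real.pi) * (x + n) = 0 := by linarith
    rcases mul_eq_zero.1 h3 with h | h
    · linarith
    · push_cast; linarith
  · rintro ⟨n, rfl⟩
    exact fourierExp_intCast n

theorem norm_fourierExp_sub_le (x y : ℝ) :
    ‖fourierExp x - fourierExp y‖ ≤ 2 * Real.pi * |x - y| := by
  have h1 : fourierExp x - fourierExp y = fourierExp y * (fourierExp (x - y) - 1) := by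
    rw [mul_sub, ← fourierExp_add]; ring_nf
  rw [h1, norm_mul, norm_fourierExp, one_mul, fourierExp, mul_comm]
  refine (Real.norm_exp_I_mul_ofReal_sub_one_le).trans (le_of_eq ?_)
  rw [Real.norm_eq_abs, abs_mul, abs_mul, abs_neg, abs_of_pos Real.pi_pos]
  norm_num

theorem sum_fourierExp (N : ℕ) (b : ℤ) (hb : |b| < N) :
    ∑ n ∈ Finset.Icc 1 N, fourierExp (((n : ℝ) - 1) * (b / N)) = if b = 0 then (N : ℂ) else 0 := by
  have hN : (N : ℝ) ≠ 0 := by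
    have : (0 : ℤ) < N := lt_of_le_of_lt (abs_nonneg b) hb
    exact_mod_cast this.ne'
  split_ifs with h
  · simp [h, fourierExp_zero]
  have hpow : ∀ n : ℕ, fourierExp (n * (b / N)) = fourierExp (b / N) ^ n := by
    intro n
    rw [fourierExp, fourierExp, ← Complex.exp_nat_mul]
    congr 1
    push_cast
    ring
  have h1 : ∑ n ∈ Finset.Icc 1 N, fourierExp (((n : ℝ) - 1) * (b / N)) =
      ∑ n ∈ Finset.range N, fourierExp (b / N) ^ n := by
    rw [Finset.range_eq_Ico, Finset.sum_Ico_eq_sum_range, ← Finset.Ico_succ_right_eq_Icc,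
      Finset.sum_Ico_eq_sum_range]
    simp only [Nat.succ_eq_succ, Nat.succ_eq_add_one, Nat.add_sub_cancel, Nat.sub_zero]
    refine Finset.sum_congr rfl fun n _ => ?_
    rw [zero_add, ← hpow]
    congr 1
    push_cast
    ring
  have hne : fourierExp (b / N) ≠ 1 := by
    rw [Ne, fourierExp_eq_one_iff]
    rintro ⟨n, hn⟩
    rw [div_eq_iff hN] at hn
    have hn' : b = n * N := by exact_mod_cast hn
    have hn0 : n ≠ 0 := by rintro rfl; simp at hn'; exact h hn'
    have : (1 : ℤ) ≤ |n| := Int.one_le_abs hn0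
    rw [hn', abs_mul] at hb
    have : |(N : ℤ)| = N := abs_of_nonneg (by positivity)
    nlinarith
  rw [h1, geom_sum_eq hne, ← hpow, mul_div_cancel₀ _ hN, fourierExp_intCast]
  simp

/-- The complex-valued Fourier series `∑_u r_u e^{-2 i π u ν}`. -/
def fourierSeries (r : ℤ → ℂ) (ν : ℝ) : ℂ := ∑' u : ℤ, r u * fourierExp (u * ν)

/-- At most `|u|` points of a window are moved out of it by a shift of `u`. -/
theorem card_filter_shift_le (N : ℕ) (u : ℤ) :
    (((Finset.Icc 1 N).filter fun n : ℕ => ¬ (1 ≤ (n : ℤ) + u ∧ (n : ℤ) + u ≤ N)).card : ℝ) ≤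
      |(u : ℝ)| := by
  have h : ((Finset.Icc 1 N).filter fun n : ℕ => ¬ (1 ≤ (n : ℤ) + u ∧ (n : ℤ) + u ≤ N)).card ≤
      u.natAbs := by
    rcases le_total 0 u with hu | hu
    · refine (Finset.card_le_card (t := Finset.Ioc (N - u.natAbs) N) fun n hn => ?_).trans ?_
      · simp only [Finset.mem_filter, Finset.mem_Icc, Finset.mem_Ioc] at hn ⊢
        omega
      · rw [Nat.card_Ioc]; omega
    · refine (Finset.card_le_card (t := Finset.Icc 1 u.natAbs) fun n hn => ?_).trans ?_
      · simp only [Finset.mem_filter, Finset.mem_Icc] at hn ⊢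
        omega
      · rw [Nat.card_Icc]; omega
  have h2 : ((u.natAbs : ℕ) : ℝ) = |(u : ℝ)| := by
    rw [Nat.cast_natAbs]; push_cast; rfl
  rw [← h2]
  exact_mod_cast h

section Covariance

variable {r : ℤ → ℂ} {K : ℝ}

/-- A weighted `ℓ¹` bound `∑ (1 + |u|) |r_u| ≤ K` on a covariance sequence. -/
structure WeightedSummable (r : ℤ → ℂ) (K : ℝ) : Prop where
  summable : Summable fun u : ℤ => (1 + |(u : ℝ)|) * ‖r u‖
  tsum_le : ∑' u : ℤ, (1 + |(u : ℝ)|) * ‖r u‖ ≤ K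

theorem WeightedSummable.summable_norm (h : WeightedSummable r K) : Summable fun u => ‖r u‖ :=
  h.summable.of_nonneg_of_le (fun _ => norm_nonneg _) fun u => by
    nlinarith [norm_nonneg (r u), abs_nonneg (u : ℝ)]

theorem WeightedSummable.summable_abs_mul (h : WeightedSummable r K) :
    Summable fun u : ℤ => |(u : ℝ)| * ‖r u‖ :=
  h.summable.of_nonneg_of_le (fun _ => by positivity) fun u => by
    nlinarith [norm_nonneg (r u), abs_nonneg (u : ℝ)]

theorem WeightedSummable.tsum_abs_mul_le (h : WeightedSummable r K) :
    ∑' u : ℤ, |(u : ℝ)| * ‖r u‖ ≤ K :=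
  (h.summable_abs_mul.tsum_le_tsum (fun u => by nlinarith [norm_nonneg (r u)])
    h.summable).trans h.tsum_le

theorem WeightedSummable.nonneg (h : WeightedSummable r K) : 0 ≤ K :=
  (tsum_nonneg fun _ => by positivity).trans h.tsum_le

theorem WeightedSummable.summable_fourier (h : WeightedSummable r K) (ν : ℝ) :
    Summable fun u : ℤ => r u * fourierExp (u * ν) := by
  refine Summable.of_norm ?_
  simpa [norm_fourierExp] using h.summable_norm

theorem WeightedSummable.norm_fourierSeries_sub_le (h : WeightedSummable r K) (x y : ℝ) :
    ‖fourierSeries r x - fourierSeries r y‖ ≤ 2 * Real.pi * K * |x - y| := by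
  rw [fourierSeries, fourierSeries, ← (h.summable_fourier x).tsum_sub (h.summable_fourier y)]
  have hb : ∀ u : ℤ, ‖r u * fourierExp (u * x) - r u * fourierExp (u * y)‖ ≤
      2 * Real.pi * |x - y| * (|(u : ℝ)| * ‖r u‖) := by
    intro u
    rw [← mul_sub, norm_mul]
    have := norm_fourierExp_sub_le (u * x) (u * y)
    rw [← mul_sub, abs_mul] at this
    calc _ ≤ ‖r u‖ * (2 * Real.pi * (|(u : ℝ)| * |x - y|)) := by gcongr
      _ = _ := by ring
  refine (tsum_of_norm_bounded (h.summable_abs_mul.hasSum.mul_left _) hb).trans ?_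
  have := h.tsum_abs_mul_le
  have hp : 0 ≤ 2 * Real.pi * |x - y| := by have := Real.pi_pos; positivity
  nlinarith [mul_le_mul_of_nonneg_left this hp]

/-- Truncating the Fourier series to the lags available in a window of length `N`, and summing over
the window, costs at most `∑ |u| |r_u|`: the lag `u` is missing `min |u| N` times. -/
theorem WeightedSummable.norm_sum_truncated_le (h : WeightedSummable r K) (N : ℕ) (ν : ℝ)
    (w : ℕ → ℂ) (hw : ∀ n, ‖w n‖ ≤ 1) :
    ‖∑ n ∈ Finset.Icc 1 N, w n * (∑ m ∈ Finset.Icc 1 N,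
        r ((m : ℤ) - n) * fourierExp ((((m : ℤ) - n : ℤ) : ℝ) * ν)) -
      (∑ n ∈ Finset.Icc 1 N, w n) * fourierSeries r ν‖ ≤ K := by
  classical
  -- `U n` is the set of lags `m - n` seen from `n`, and `d n` the mass of the missing lags
  set U : ℕ → Finset ℤ := fun n => (Finset.Icc 1 N).image fun m : ℕ => (m : ℤ) - n with hU
  have hmem : ∀ (n : ℕ) (u : ℤ), u ∈ U n ↔ 1 ≤ (n : ℤ) + u ∧ (n : ℤ) + u ≤ N := by
    intro n u
    simp only [hU, Finset.mem_image, Finset.mem_Icc]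
    constructor
    · rintro ⟨m, hm, rfl⟩; omega
    · intro hu
      exact ⟨((n : ℤ) + u).toNat, by omega, by omega⟩
  set d : ℕ → ℤ → ℝ := fun n u => if u ∈ U n then 0 else ‖r u‖ with hd
  have hds : ∀ n, Summable (d n) := fun n =>
    h.summable_norm.of_nonneg_of_le (fun u => by simp only [hd]; split_ifs <;> simp)
      fun u => by simp only [hd]; split_ifs <;> simp
  have hdiff : ∀ n : ℕ, ‖(∑ m ∈ Finset.Icc 1 N,
      r ((m : ℤ) - n) * fourierExp ((((m : ℤ) - n : ℤ) : ℝ) * ν)) - fourierSeries r ν‖ ≤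
      ∑' u, d n u := by
    intro n
    have h1 : ∑ m ∈ Finset.Icc 1 N,
        r ((m : ℤ) - n) * fourierExp ((((m : ℤ) - n : ℤ) : ℝ) * ν) =
        ∑ u ∈ U n, r u * fourierExp (u * ν) := by
      rw [hU, Finset.sum_image]
      intro a _ b _ hab
      simpa using hab
    have h2 : HasSum (fun u => if u ∈ U n then r u * fourierExp (u * ν) else 0)
        (∑ u ∈ U n, r u * fourierExp (u * ν)) := by
      have h0 : HasSum (fun u => if u ∈ U n then r u * fourierExp (u * ν) else 0)
          (∑ u ∈ U n, if u ∈ U n then r u * fourierExp (u * ν) else 0) :=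
        hasSum_sum_of_ne_finset_zero fun u hu => by simp [hu]
      rwa [Finset.sum_congr rfl fun u hu => if_pos hu] at h0
    have h3 := h2.sub (h.summable_fourier ν).hasSum
    rw [h1]
    refine h3.norm_le_of_bounded (hds n).hasSum fun u => ?_
    simp only [hd]
    split_ifs <;> simp [norm_fourierExp]
  rw [Finset.sum_mul, ← Finset.sum_sub_distrib]
  calc _ ≤ ∑ n ∈ Finset.Icc 1 N, ∑' u, d n u := by
        refine norm_sum_le_of_le _ fun n _ => ?_
        rw [← mul_sub, norm_mul]
        calc _ ≤ 1 * ∑' u, d n u := mul_le_mul (hw n) (hdiff n) (norm_nonneg _) zero_le_one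
          _ = _ := one_mul _
    _ = ∑' u, ∑ n ∈ Finset.Icc 1 N, d n u := (Summable.tsum_finsetSum fun n _ => hds n).symm
    _ ≤ ∑' u : ℤ, |(u : ℝ)| * ‖r u‖ := by
        refine (summable_sum fun n _ => hds n).tsum_le_tsum (fun u => ?_) h.summable_abs_mul
        have : ∑ n ∈ Finset.Icc 1 N, d n u = ((Finset.Icc 1 N).filter
            fun n : ℕ => ¬ (1 ≤ (n : ℤ) + u ∧ (n : ℤ) + u ≤ N)).card * ‖r u‖ := by
          rw [← nsmul_eq_mul, ← Finset.sum_const, Finset.sum_filter]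
          refine Finset.sum_congr rfl fun n _ => ?_
          simp only [hd, hmem]
          split_ifs <;> rfl
        rw [this]
        exact mul_le_mul_of_nonneg_right (card_filter_shift_le N u) (norm_nonneg _)
    _ ≤ K := h.tsum_abs_mul_le

end Covariance

variable {Ω : Type*} [MeasurableSpace Ω] {μ : Measure Ω}

theorem xi_eq_sum {Ω : Type*} (y : ℤ → Ω → ℂ) (N : ℕ) (ν : ℝ) (ω : Ω) :
    xi y N ν ω = ∑ n ∈ Finset.Icc 1 N,
      (1 / (√N : ℂ)) * fourierExp (((n : ℝ) - 1) * ν) * y n ω := by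
  rw [xi, Finset.mul_sum]
  refine Finset.sum_congr rfl fun n _ => ?_
  have : Complex.exp (-2 * Complex.I * Real.pi * ((n : ℂ) - 1) * ν) =
      fourierExp (((n : ℝ) - 1) * ν) := by
    rw [fourierExp]
    congr 1
    push_cast
    ring
  rw [this]
  ring

theorem measurable_xi {y : ℤ → Ω → ℂ} (hy : ∀ n, Measurable (y n)) (N : ℕ) (ν : ℝ) :
    Measurable (xi y N ν) := by
  have : xi y N ν = fun ω => ∑ n ∈ Finset.Icc 1 N,
      (1 / (√N : ℂ)) * fourierExp (((n : ℝ) - 1) * ν) * y n ω := funext (xi_eq_sum y N ν)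
  rw [this]
  fun_prop

theorem spectralDensity_eq (y : ℤ → Ω → ℂ) (ν : ℝ) :
    spectralDensity μ y ν = (fourierSeries (autocov μ y) ν).re := by
  rw [spectralDensity, fourierSeries]
  congr 2 with u
  rw [fourierExp]
  congr 2
  push_cast
  ring

namespace IsStationaryComplexGaussian

variable {y : ℤ → Ω → ℂ} {K : ℝ}

theorem memLp (h : IsStationaryComplexGaussian μ y) (n : ℤ) : MemLp (y n) 2 μ := by
  obtain ⟨v, hv⟩ := h.gaussian {n} 1
  simpa using hv.memLp

theorem integral_xi_mul_conj (h : IsStationaryComplexGaussian μ y) (N : ℕ) (ν ν' : ℝ) :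
    ∫ ω, xi y N ν ω * conj (xi y N ν' ω) ∂μ = (1 / N : ℂ) *
      ∑ n ∈ Finset.Icc 1 N, fourierExp (((n : ℝ) - 1) * (ν - ν')) * ∑ m ∈ Finset.Icc 1 N,
        autocov μ y ((m : ℤ) - n) * fourierExp ((((m : ℤ) - n : ℤ) : ℝ) * ν) := by
  have hI : ∀ (m n : ℕ) (a b : ℂ), Integrable (fun ω => a * y m ω * conj (b * y n ω)) μ := by
    intro m n a b
    refine (((h.memLp m).integrable_mul_conj (h.memLp n)).const_mul (a * conj b)).congr
      (Eventually.of_forall fun ω => ?_)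
    simp only [map_mul]
    ring
  simp only [xi_eq_sum, map_sum, Finset.sum_mul_sum]
  rw [integral_finsetSum _ fun m _ => integrable_finsetSum _ fun n _ => hI _ _ _ _]
  rw [Finset.sum_congr rfl fun m _ => integral_finsetSum _ fun n _ => hI _ _ _ _]
  rw [Finset.sum_comm, Finset.mul_sum]
  refine Finset.sum_congr rfl fun n _ => ?_
  rw [Finset.mul_sum, Finset.mul_sum]
  refine Finset.sum_congr rfl fun m _ => ?_
  have hst : ∫ ω, y m ω * conj (y n ω) ∂μ = autocov μ y ((m : ℤ) - n) := by
    rw [← h.stationary n ((m : ℤ) - n)]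
    simp
  have hNN : (1 / (√N : ℂ)) * conj (1 / (√N : ℂ)) = 1 / N := by
    rw [map_div₀, map_one, Complex.conj_ofReal, div_mul_div_comm, one_mul, ← Complex.ofReal_mul,
      Real.mul_self_sqrt (by positivity), Complex.ofReal_natCast]
  have hph : fourierExp (((m : ℝ) - 1) * ν) * conj (fourierExp (((n : ℝ) - 1) * ν')) =
      fourierExp (((n : ℝ) - 1) * (ν - ν')) * fourierExp ((((m : ℤ) - n : ℤ) : ℝ) * ν) := by
    rw [conj_fourierExp, ← fourierExp_add, ← fourierExp_add]
    congr 1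
    push_cast
    ring
  calc _ = ∫ ω, ((1 / (√N : ℂ)) * conj (1 / (√N : ℂ))) * (fourierExp (((m : ℝ) - 1) * ν) *
        conj (fourierExp (((n : ℝ) - 1) * ν'))) * (y m ω * conj (y n ω)) ∂μ := by
        congr 1 with ω
        simp only [map_mul]
        ring
    _ = _ := by
        rw [integral_const_mul, hst, hNN, hph]
        ring

/-- Up to `O(1 / N)`, the Fourier transforms at frequencies differing by multiples of `1 / N` are
uncorrelated, with variance the Fourier series of the autocovariance. -/
theorem norm_integral_xi_mul_conj_sub_le (h : IsStationaryComplexGaussian μ y)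
    (hK : WeightedSummable (autocov μ y) K) {N : ℕ} (ν ν' : ℝ) (b : ℤ) (hb : |b| < N)
    (hν : ν - ν' = b / N) :
    ‖∫ ω, xi y N ν ω * conj (xi y N ν' ω) ∂μ -
      if b = 0 then fourierSeries (autocov μ y) ν else 0‖ ≤ K / N := by
  have hN : 0 < N := by
    have : (0 : ℤ) < N := lt_of_le_of_lt (abs_nonneg b) hb
    exact_mod_cast this
  have hNC : (N : ℂ) ≠ 0 := by exact_mod_cast hN.ne'
  have h1 := hK.norm_sum_truncated_le N ν (fun n => fourierExp (((n : ℝ) - 1) * (ν - ν')))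
    fun n => (norm_fourierExp _).le
  have h2 := sum_fourierExp N b hb
  rw [← hν] at h2
  rw [h2] at h1
  rw [h.integral_xi_mul_conj]
  have h3 : (if b = 0 then fourierSeries (autocov μ y) ν else 0) =
      (1 / N : ℂ) * ((if b = 0 then (N : ℂ) else 0) * fourierSeries (autocov μ y) ν) := by
    split_ifs
    · field_simp
    · simp
  rw [h3, ← mul_sub, norm_mul, norm_div, norm_one, Complex.norm_natCast, one_div_mul_eq_div]
  gcongr

/-- The spectral density is nonnegative, and the Fourier series is real: taking its real part in
`spectralDensity` loses nothing. -/
theorem fourierSeries_eq (h : IsStationaryComplexGaussian μ y)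
    (hK : WeightedSummable (autocov μ y) K) (ν : ℝ) :
    0 ≤ spectralDensity μ y ν ∧ fourierSeries (autocov μ y) ν = spectralDensity μ y ν := by
  -- the Fourier series is the limit of the nonnegative numbers `𝔼|ξ_N(ν)|²`
  have hlim : Tendsto (fun N : ℕ => ((∫ ω, ‖xi y N ν ω‖ ^ 2 ∂μ : ℝ) : ℂ)) atTop
      (𝓝 (fourierSeries (autocov μ y) ν)) := by
    rw [tendsto_iff_norm_sub_tendsto_zero]
    refine squeeze_zero' (Eventually.of_forall fun _ => norm_nonneg _) ?_
      (tendsto_const_div_atTop_nhds_zero_nat K)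
    filter_upwards [eventually_gt_atTop 0] with N hN
    have := h.norm_integral_xi_mul_conj_sub_le hK (N := N) ν ν 0 (by simpa using hN) (by simp)
    rw [if_pos rfl] at this
    convert! this using 3
    rw [← integral_complex_ofReal]
    congr 1 with ω
    rw [Complex.mul_conj']
    push_cast
    rfl
  have hre := (Complex.continuous_re.tendsto _).comp hlim
  have him := (Complex.continuous_im.tendsto _).comp hlim
  have h0 : (fourierSeries (autocov μ y) ν).im = 0 :=
    tendsto_nhds_unique him (by simp [Function.comp_def])
  rw [spectralDensity_eq]
  refine ⟨ge_of_tendsto' hre fun N => ?_, ?_⟩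
  · simp only [Function.comp, Complex.ofReal_re]
    exact integral_nonneg fun ω => by positivity
  · exact Complex.ext (by simp) (by simp [h0])

end IsStationaryComplexGaussian

end

/-! ### Whitening the normalized Fourier transforms -/

section

open scoped Matrix.Norms.L2Operator

theorem l2_opNorm_le_of_entry_le {p : ℕ} (A : Matrix (Fin p) (Fin p) ℂ) {ε : ℝ} (hε : 0 ≤ ε)
    (h : ∀ i j, ‖A i j‖ ≤ ε) : ‖A‖ ≤ p * ε := by
  refine l2_opNorm_le_of_mulVec _ (by positivity) fun u => ?_
  refine abs_le_of_sq_le_sq' ?_ (by positivity) |>.2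
  rw [mul_pow, EuclideanSpace.norm_sq_eq, EuclideanSpace.norm_sq_eq]
  have h1 : ∀ i, ‖(A *ᵥ u) i‖ ^ 2 ≤ ε ^ 2 * (p * ∑ j, ‖u j‖ ^ 2) := by
    intro i
    have h2 : ‖(A *ᵥ u) i‖ ≤ ε * ∑ j, ‖u j‖ := by
      rw [Matrix.mulVec, dotProduct, Finset.mul_sum]
      refine norm_sum_le_of_le _ fun j _ => ?_
      rw [norm_mul]
      exact mul_le_mul_of_nonneg_right (h i j) (norm_nonneg _)
    have h3 := sq_sum_le_card_mul_sum_sq (s := Finset.univ) (f := fun j => ‖u j‖)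
    rw [Finset.card_univ, Fintype.card_fin] at h3
    calc _ ≤ (ε * ∑ j, ‖u j‖) ^ 2 := by gcongr
      _ = ε ^ 2 * (∑ j, ‖u j‖) ^ 2 := by ring
      _ ≤ _ := by gcongr
  calc _ ≤ ∑ i : Fin p, ε ^ 2 * (p * ∑ j, ‖u j‖ ^ 2) := Finset.sum_le_sum fun i _ => h1 i
    _ = _ := by
      rw [Finset.sum_const, Finset.card_univ, Fintype.card_fin, nsmul_eq_mul]
      ring

theorem l2_opNorm_one_le (p : ℕ) : ‖(1 : Matrix (Fin p) (Fin p) ℂ)‖ ≤ 1 :=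
  l2_opNorm_le_of_mulVec _ zero_le_one fun u => by simp

variable {Ω : Type*}

/-- The row `(ξ(ν + b/N) / √s(ν))_{|b| ≤ B/2}` of normalized Fourier transforms of one series; the
index `k` of `Fin (B + 1)` stands for `b = k - B / 2`. -/
def normalizedRow [MeasurableSpace Ω] (μ : Measure Ω) (y : ℤ → Ω → ℂ) (N B : ℕ) (ν : ℝ)
    (k : Fin (B + 1)) (ω : Ω) : ℂ :=
  (((√(spectralDensity μ y ν))⁻¹ : ℝ) : ℂ) * xi y N (ν + (((k : ℤ) - (B : ℤ) / 2 : ℤ) : ℝ) / N) ω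

theorem smoothedPeriodogram_apply (y : ℕ → ℤ → Ω → ℂ) (N M : ℕ) {B : ℕ} (hB : Even B) (ν : ℝ)
    (ω : Ω) (i j : Fin M) :
    smoothedPeriodogram y N M B ν ω i j = (1 / ((B : ℂ) + 1)) * ∑ k : Fin (B + 1),
      xi (y i) N (ν + (((k : ℤ) - (B : ℤ) / 2 : ℤ) : ℝ) / N) ω *
        conj (xi (y j) N (ν + (((k : ℤ) - (B : ℤ) / 2 : ℤ) : ℝ) / N) ω) := by
  rw [smoothedPeriodogram, Matrix.smul_apply, Matrix.sum_apply, smul_eq_mul]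
  congr 1
  obtain ⟨c, rfl⟩ := hB
  refine (Finset.sum_bij (fun (k : Fin (c + c + 1)) _ => (k : ℤ) - ((c + c : ℕ) : ℤ) / 2)
    ?_ ?_ ?_ ?_).symm
  · intro k _
    have := k.2
    rw [Finset.mem_Icc]
    omega
  · intro k _ l _ hkl
    exact Fin.ext (by omega)
  · intro b hb
    rw [Finset.mem_Icc] at hb
    refine ⟨⟨(b + c).toNat, by omega⟩, Finset.mem_univ _, ?_⟩
    simp only
    omega
  · intro k _
    rw [Matrix.vecMulVec_apply]

theorem coherencyTilde_eq [MeasurableSpace Ω] (μ : Measure Ω) (y : ℕ → ℤ → Ω → ℂ) (N M : ℕ)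
    {B : ℕ} (hB : Even B) (ν : ℝ) (ω : Ω) :
    coherencyTilde μ y N M B ν ω = (1 / ((B : ℂ) + 1)) •
      ((Matrix.of fun (i : Fin M) k => normalizedRow μ (y i) N B ν k ω) *
        (Matrix.of fun (i : Fin M) k => normalizedRow μ (y i) N B ν k ω)ᴴ) := by
  ext i j
  rw [coherencyTilde, invSqrtDiag, Matrix.mul_diagonal, Matrix.diagonal_mul,
    smoothedPeriodogram_apply y N M hB, Matrix.smul_apply, Matrix.mul_apply, smul_eq_mul]
  simp only [spectralMatrix, Matrix.diagonal_apply_eq, Complex.ofReal_re, Matrix.of_apply,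
    Matrix.conjTranspose_apply, normalizedRow, RCLike.star_def, map_mul, Complex.conj_ofReal,
    Finset.mul_sum, Finset.sum_mul]
  refine Finset.sum_congr rfl fun k _ => ?_
  ring

variable [MeasurableSpace Ω] {μ : Measure Ω}

theorem measurable_normalizedRow {y : ℤ → Ω → ℂ} (hy : ∀ n, Measurable (y n)) (N B : ℕ) (ν : ℝ)
    (k : Fin (B + 1)) : Measurable (normalizedRow μ y N B ν k) :=
  (measurable_xi hy N _).const_mul _

namespace IsStationaryComplexGaussian

variable {y : ℤ → Ω → ℂ} {K κ : ℝ}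

theorem isComplexGaussianVector_normalizedRow (h : IsStationaryComplexGaussian μ y) (N B : ℕ)
    (ν : ℝ) : IsComplexGaussianVector μ (normalizedRow μ y N B ν) := by
  refine ⟨measurable_normalizedRow h.measurable N B ν, fun a => ?_⟩
  obtain ⟨v, hv⟩ := h.gaussian ((Finset.Icc 1 N).map Nat.castEmbedding) fun n =>
    ∑ k : Fin (B + 1), a k * ((((√(spectralDensity μ y ν))⁻¹ : ℝ) : ℂ) * ((1 / (√N : ℂ)) *
      fourierExp (((n : ℝ) - 1) * (ν + (((k : ℤ) - (B : ℤ) / 2 : ℤ) : ℝ) / N))))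
  refine ⟨v, ?_⟩
  convert hv using 2 with ω
  simp only [normalizedRow, xi_eq_sum, Finset.sum_map, Nat.castEmbedding_apply, Finset.mul_sum,
    Finset.sum_mul, Int.cast_natCast]
  rw [Finset.sum_comm]
  refine Finset.sum_congr rfl fun n _ => Finset.sum_congr rfl fun k _ => ?_
  ring

/-- The normalized Fourier transforms over a band of `B + 1` frequencies are uncorrelated with unit
variance, up to an error `O(B / N)` in operator norm. -/
theorem norm_covMatrix_normalizedRow_sub_one_le (h : IsStationaryComplexGaussian μ y)
    (hK : WeightedSummable (autocov μ y) K) (hκ : 0 < κ) {ν : ℝ} (hs : κ ≤ spectralDensity μ y ν)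
    {N B : ℕ} (hBN : B < N) :
    ‖covMatrix μ (normalizedRow μ y N B ν) - 1‖ ≤ 8 * K / κ * ((B + 1) / N) := by
  have hK0 := hK.nonneg
  have hN : (0 : ℝ) < N := by exact_mod_cast Nat.zero_lt_of_lt hBN
  set s := spectralDensity μ y ν with hsdef
  have hs0 : 0 < s := hκ.trans_le hs
  set f : Fin (B + 1) → ℝ := fun k => ν + (((k : ℤ) - (B : ℤ) / 2 : ℤ) : ℝ) / N with hf
  -- `E` collects the correlations of order `1 / N`, `D` the variation of the spectral density
  set E : Matrix (Fin (B + 1)) (Fin (B + 1)) ℂ := Matrix.of fun k l =>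
    ∫ ω, xi y N (f k) ω * conj (xi y N (f l) ω) ∂μ -
      if (k : ℤ) - l = 0 then fourierSeries (autocov μ y) (f k) else 0 with hE
  set D : Fin (B + 1) → ℂ := fun k =>
    fourierSeries (autocov μ y) (f k) - fourierSeries (autocov μ y) ν with hD
  have hG : covMatrix μ (normalizedRow μ y N B ν) - 1 =
      ((s⁻¹ : ℝ) : ℂ) • (E + Matrix.diagonal D) := by
    have hss : (((√s)⁻¹ : ℝ) : ℂ) * (((√s)⁻¹ : ℝ) : ℂ) = ((s⁻¹ : ℝ) : ℂ) := by
      rw [← Complex.ofReal_mul, ← mul_inv, Real.mul_self_sqrt hs0.le]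
    ext k l
    have h1 : covMatrix μ (normalizedRow μ y N B ν) k l =
        ((s⁻¹ : ℝ) : ℂ) * ∫ ω, xi y N (f k) ω * conj (xi y N (f l) ω) ∂μ := by
      rw [covMatrix, Matrix.of_apply, ← integral_const_mul]
      congr 1 with ω
      simp only [normalizedRow, map_mul, Complex.conj_ofReal, ← hss, ← hsdef, hf]
      ring
    rw [Matrix.sub_apply, h1, Matrix.smul_apply, Matrix.add_apply, smul_eq_mul, hE,
      Matrix.of_apply]
    rcases eq_or_ne k l with rfl | hkl
    · rw [Matrix.one_apply_eq, Matrix.diagonal_apply_eq, if_pos (sub_self _), hD,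
        (h.fourierSeries_eq hK ν).2, ← hsdef]
      have : ((s⁻¹ : ℝ) : ℂ) * s = 1 := by
        rw [← Complex.ofReal_mul, inv_mul_cancel₀ hs0.ne', Complex.ofReal_one]
      linear_combination this
    · have : (k : ℤ) - l ≠ 0 := fun h => hkl (Fin.ext (by omega))
      rw [Matrix.one_apply_ne hkl, Matrix.diagonal_apply_ne _ hkl, if_neg this]
      ring
  have hEn : ‖E‖ ≤ (B + 1) * (K / N) := by
    have := l2_opNorm_le_of_entry_le E (ε := K / N) (by positivity) fun k l => by
      rw [hE, Matrix.of_apply]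
      refine h.norm_integral_xi_mul_conj_sub_le hK (f k) (f l) ((k : ℤ) - l) ?_ ?_
      · have := k.2
        have := l.2
        rw [abs_lt]
        omega
      · simp only [hf]
        push_cast
        ring
    simpa using this
  have hDn : ‖Matrix.diagonal D‖ ≤ 7 * K * ((B + 1) / N) := by
    rw [Matrix.l2_opNorm_diagonal, pi_norm_le_iff_of_nonneg (by positivity)]
    intro k
    refine (hK.norm_fourierSeries_sub_le _ _).trans ?_
    have hk : |f k - ν| ≤ (B + 1) / N := by
      simp only [hf, add_sub_cancel_left]
      rw [abs_div, abs_of_pos hN]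
      gcongr
      have := k.2
      have h2 : |(k : ℤ) - (B : ℤ) / 2| ≤ (B : ℤ) + 1 := by rw [abs_le]; omega
      exact_mod_cast h2
    have hpi := Real.pi_lt_d2
    have : 2 * Real.pi * K ≤ 7 * K := by nlinarith
    exact mul_le_mul this hk (abs_nonneg _) (by positivity)
  rw [hG, norm_smul, Complex.norm_real, Real.norm_eq_abs, abs_of_pos (inv_pos.2 hs0)]
  calc s⁻¹ * ‖E + Matrix.diagonal D‖ ≤ κ⁻¹ * ((B + 1) * (K / N) + 7 * K * ((B + 1) / N)) :=
        mul_le_mul (inv_anti₀ hκ hs) ((norm_add_le _ _).trans (add_le_add hEn hDn))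
          (norm_nonneg _) (inv_nonneg.2 hκ.le)
    _ = _ := by ring

/-- Whitening of one row: `ζ = (1 + F) X` with `X = W ζ` standard and `F` of size `B / N`. -/
theorem exists_whitening (h : IsStationaryComplexGaussian μ y)
    (hK : WeightedSummable (autocov μ y) K) (hκ : 0 < κ) {ν : ℝ} (hs : κ ≤ spectralDensity μ y ν)
    {N B : ℕ} (hBN : B < N) {δ : ℝ} (hδ : 8 * K / κ * ((B + 1) / N) ≤ δ) (hδ1 : δ < 1) :
    ∃ W F : Matrix (Fin (B + 1)) (Fin (B + 1)) ℂ, ‖F‖ ≤ δ ∧ (1 + F) * W = 1 ∧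
      IsStdComplexGaussianVector μ (fun k ω => ∑ l, W k l * normalizedRow μ y N B ν l ω) := by
  obtain ⟨H, hH, hHH, hHu, hHn⟩ := exists_sqrt_near_one
    (covMatrix_isHermitian (μ := μ) (normalizedRow μ y N B ν)).isSelfAdjoint
    ((h.norm_covMatrix_normalizedRow_sub_one_le hK hκ hs hBN).trans hδ) hδ1
  have hdet : IsUnit H.det := (Matrix.isUnit_iff_isUnit_det H).1 hHu
  have hHH' : Hᴴ = H := hH
  have hg := h.isComplexGaussianVector_normalizedRow N B ν
  refine ⟨H⁻¹, H - 1, hHn, ?_, (hg.mulVec H⁻¹).isStd ?_⟩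
  · rw [add_sub_cancel, Matrix.mul_nonsing_inv _ hdet]
  · rw [covMatrix_mulVec hg.memLp, ← hHH, Matrix.conjTranspose_nonsing_inv, hHH', mul_assoc,
      mul_assoc, Matrix.mul_nonsing_inv _ hdet, mul_one, Matrix.nonsing_inv_mul _ hdet]

end IsStationaryComplexGaussian

/-- Whitening all the rows gives the normalized Fourier transforms as a perturbation of a matrix
with independent standard rows. -/
theorem exists_hasIndepStdRows {y : ℕ → ℤ → Ω → ℂ} {K κ : ℝ}
    (hgauss : ∀ m, IsStationaryComplexGaussian μ (y m))
    (hindep : iIndepFun (fun (m : ℕ) (ω : Ω) (n : ℤ) => y m n ω) μ)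
    (hK : ∀ m, WeightedSummable (autocov μ (y m)) K) (hκ : 0 < κ) {ν : ℝ}
    (hs : ∀ m, κ ≤ spectralDensity μ (y m) ν) {N B : ℕ} (M : ℕ) (hBN : B < N) {δ : ℝ}
    (hδ : 8 * K / κ * ((B + 1) / N) ≤ δ) (hδ1 : δ < 1) :
    ∃ (X : Fin M → Fin (B + 1) → Ω → ℂ) (F : Fin M → Matrix (Fin (B + 1)) (Fin (B + 1)) ℂ),
      HasIndepStdRows μ X ∧ (∀ i, ‖F i‖ ≤ δ) ∧
      ∀ (i : Fin M) k ω, normalizedRow μ (y i) N B ν k ω = X i k ω + ∑ l, F i k l * X i l ω := by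
  choose W F hF hWF hW using fun m => (hgauss m).exists_whitening (hK m) hκ (hs m) hBN hδ hδ1
  refine ⟨fun i k ω => ∑ l, W i k l * normalizedRow μ (y i) N B ν l ω, fun i => F i,
    ⟨fun i => hW i, ?_⟩, fun i => hF i, fun i k ω => ?_⟩
  · have hind : iIndepFun (fun (i : Fin M) (ω : Ω) (n : ℤ) => y i n ω) μ :=
      hindep.precomp (g := fun i : Fin M => (i : ℕ)) Fin.val_injective
    refine hind.comp (fun i (x : ℤ → ℂ) k => ∑ l, W i k l *
      ((((√(spectralDensity μ (y i) ν))⁻¹ : ℝ) : ℂ) * xi (fun n (x : ℤ → ℂ) => x n) N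
        (ν + (((l : ℤ) - (B : ℤ) / 2 : ℤ) : ℝ) / N) x)) fun i => ?_
    have := fun ν => measurable_xi (Ω := ℤ → ℂ) (y := fun n x => x n)
      (fun n => measurable_pi_apply n) N ν
    fun_prop
  · have h1 : (1 + F i) *ᵥ (W i *ᵥ fun l => normalizedRow μ (y i) N B ν l ω) =
        fun l => normalizedRow μ (y i) N B ν l ω := by
      rw [Matrix.mulVec_mulVec, hWF, Matrix.one_mulVec]
    have h2 := congrFun h1 k
    rw [Matrix.add_mulVec, Matrix.one_mulVec] at h2
    exact h2.symm

end

/-! ### Deterministic bounds and the tame event -/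

section

open scoped Matrix.Norms.L2Operator

theorem norm_entry_le_l2_opNorm {p : ℕ} (A : Matrix (Fin p) (Fin p) ℂ) (i j : Fin p) :
    ‖A i j‖ ≤ ‖A‖ := by
  have h1 := norm_toLp_mulVec_le A (Pi.single j 1)
  have h2 : ‖WithLp.toLp 2 (Pi.single j (1 : ℂ) : Fin p → ℂ)‖ = 1 := by simp
  rw [h2, mul_one] at h1
  refine le_trans ?_ h1
  have h3 := PiLp.norm_apply_le (WithLp.toLp 2 (A *ᵥ Pi.single j 1)) i
  simpa using h3

/-- The normalized Gram matrix `Z Zᴴ / (B + 1)`. -/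
def gram {p B : ℕ} (Z : Matrix (Fin p) (Fin (B + 1)) ℂ) : Matrix (Fin p) (Fin p) ℂ :=
  (1 / ((B : ℂ) + 1)) • (Z * Zᴴ)

theorem norm_one_div_add_one (B : ℕ) : ‖(1 / ((B : ℂ) + 1))‖ = 1 / ((B : ℝ) + 1) := by
  rw [norm_div, norm_one]
  congr 1
  rw [← Nat.cast_succ, Complex.norm_natCast, Nat.cast_succ]

/-- The bounds satisfied, with high probability, by a standard Gaussian matrix `X` and a
perturbation `Z` of relative size `δ`. -/
structure IsTame {p B : ℕ} (X Z : Matrix (Fin p) (Fin (B + 1)) ℂ) (δ τ : ℝ) : Prop where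
  norm_sub_le : ‖gram Z - gram X‖ ≤ 3 * δ * τ ^ 2
  norm_gram_le : ‖gram X‖ ≤ τ ^ 2
  norm_gram_le' : ‖gram Z‖ ≤ 4 * τ ^ 2
  diag_le : ∀ i, |(gram Z i i).re - 1| ≤ τ / √(B + 1) + 3 * δ * τ ^ 2

/-- The two operator norm bounds and the concentration of the diagonal imply tameness, by expanding
`(X + R) (X + R)ᴴ`. -/
theorem isTame_of_bounds {p B : ℕ} {X R : Matrix (Fin p) (Fin (B + 1)) ℂ} {δ τ : ℝ} (hδ : 0 ≤ δ)
    (hδ1 : δ ≤ 1) (hτ : 0 ≤ τ) (hX : ‖X‖ ≤ τ * √(B + 1)) (hR : ‖R‖ ≤ δ * τ * √(B + 1))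
    (hd : ∀ i, |∑ k, ‖X i k‖ ^ 2 - (B + 1)| ≤ τ * √(B + 1)) : IsTame X (X + R) δ τ := by
  have hq : (0 : ℝ) < B + 1 := by positivity
  have hss : √((B : ℝ) + 1) * √(B + 1) = B + 1 := Real.mul_self_sqrt hq.le
  have hgram : ∀ (A C : Matrix (Fin p) (Fin (B + 1)) ℂ) {a c : ℝ}, 0 ≤ a → ‖A‖ ≤ a * √(B + 1) →
      ‖C‖ ≤ c * √(B + 1) → ‖(1 / ((B : ℂ) + 1)) • (A * Cᴴ)‖ ≤ a * c := by
    intro A C a c ha hA hC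
    rw [norm_smul, norm_one_div_add_one, one_div_mul_eq_div, div_le_iff₀ hq]
    calc ‖A * Cᴴ‖ ≤ ‖A‖ * ‖Cᴴ‖ := Matrix.l2_opNorm_mul _ _
      _ ≤ (a * √(B + 1)) * (c * √(B + 1)) := by
          rw [Matrix.l2_opNorm_conjTranspose]
          exact mul_le_mul hA hC (norm_nonneg _) (by positivity)
      _ = a * c * (√(B + 1) * √(B + 1)) := by ring
      _ = a * c * (B + 1) := by rw [hss]
  have hsub : ‖gram (X + R) - gram X‖ ≤ 3 * δ * τ ^ 2 := by
    have e : gram (X + R) - gram X = (1 / ((B : ℂ) + 1)) • (X * Rᴴ) +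
        (1 / ((B : ℂ) + 1)) • (R * Xᴴ) + (1 / ((B : ℂ) + 1)) • (R * Rᴴ) := by
      rw [gram, gram, ← smul_sub, ← smul_add, ← smul_add, Matrix.conjTranspose_add, Matrix.add_mul,
        Matrix.mul_add, Matrix.mul_add]
      congr 1
      abel
    have h1 := hgram X R hτ hX hR
    have h2 := hgram R X (mul_nonneg hδ hτ) hR hX
    have h3 := hgram R R (mul_nonneg hδ hτ) hR hR
    rw [e]
    refine (norm_add₃_le).trans ?_
    have : δ * τ * (δ * τ) ≤ δ * τ ^ 2 := by
      have := mul_le_mul_of_nonneg_right hδ1 (mul_nonneg hδ (sq_nonneg τ))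
      nlinarith
    nlinarith
  refine ⟨hsub, ?_, ?_, fun i => ?_⟩
  · rw [sq]
    exact hgram X X hτ hX hX
  · have hZ : ‖X + R‖ ≤ 2 * τ * √(B + 1) := by
      refine (norm_add_le _ _).trans ((add_le_add hX hR).trans ?_)
      have := mul_le_mul_of_nonneg_right hδ1 (mul_nonneg hτ (Real.sqrt_nonneg ((B : ℝ) + 1)))
      nlinarith
    have := hgram (X + R) (X + R) (by positivity) hZ hZ
    refine this.trans (le_of_eq ?_)
    ring
  · have h1 : (gram X i i).re - 1 = (∑ k, ‖X i k‖ ^ 2 - (B + 1)) / (B + 1) := by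
      have : gram X i i = (((∑ k, ‖X i k‖ ^ 2) / (B + 1) : ℝ) : ℂ) := by
        rw [gram, Matrix.smul_apply, Matrix.mul_apply]
        simp only [Matrix.conjTranspose_apply, RCLike.star_def, Complex.mul_conj', smul_eq_mul]
        push_cast
        ring
      rw [this, Complex.ofReal_re]
      field_simp
    have h2 : |(gram X i i).re - 1| ≤ τ / √(B + 1) := by
      rw [h1, abs_div, abs_of_pos hq, div_le_iff₀ hq]
      refine (hd i).trans (le_of_eq ?_)
      have : √((B : ℝ) + 1) ≠ 0 := by positivity
      field_simp
      rw [sq, hss]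
    have h3 : |(gram (X + R) i i).re - (gram X i i).re| ≤ 3 * δ * τ ^ 2 := by
      rw [← Complex.sub_re, ← Matrix.sub_apply]
      exact (Complex.abs_re_le_norm _).trans ((norm_entry_le_l2_opNorm _ i i).trans hsub)
    calc _ = |((gram X i i).re - 1) + ((gram (X + R) i i).re - (gram X i i).re)| := by
          congr 1; ring
      _ ≤ _ := (abs_add_le _ _).trans (add_le_add h2 h3)

/-- Renormalizing a matrix whose diagonal is within `η ≤ 1 / 2` of `1` has relative cost
`O(η)`. -/
theorem norm_invSqrtDiag_conj_sub_le {p : ℕ} (A : Matrix (Fin p) (Fin p) ℂ) {η : ℝ} (hη0 : 0 ≤ η)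
    (hη : η ≤ 1 / 2) (h : ∀ i, |(A i i).re - 1| ≤ η) :
    ‖invSqrtDiag A * A * invSqrtDiag A - A‖ ≤ 3 * η * ‖A‖ := by
  set E : Matrix (Fin p) (Fin p) ℂ := invSqrtDiag A - 1 with hE
  have hEn : ‖E‖ ≤ η := by
    have : E = Matrix.diagonal fun i => ((((√(A i i).re)⁻¹ - 1 : ℝ)) : ℂ) := by
      rw [hE, invSqrtDiag, ← Matrix.diagonal_one, Matrix.diagonal_sub]
      simp
    rw [this, Matrix.l2_opNorm_diagonal, pi_norm_le_iff_of_nonneg hη0]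
    intro i
    rw [Complex.norm_real, Real.norm_eq_abs]
    obtain ⟨h1, h2⟩ := abs_le.1 (h i)
    set d := (A i i).re
    have hd : 1 / 2 ≤ d := by linarith
    have hsd : 7 / 10 ≤ √d := Real.le_sqrt_of_sq_le (by norm_num; linarith)
    have hdd : √d * √d = d := Real.mul_self_sqrt (by linarith)
    have e : (√d)⁻¹ - 1 = (1 - d) / (√d * (1 + √d)) := by
      have : √d ≠ 0 := by positivity
      field_simp
      linear_combination -hdd
    rw [e, abs_div, abs_of_pos (a := √d * (1 + √d)) (by positivity), div_le_iff₀ (by positivity)]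
    have h3 : |1 - d| ≤ η := by rw [abs_sub_comm]; exact h i
    have h4 : 1 ≤ √d * (1 + √d) := by nlinarith
    nlinarith
  have e : invSqrtDiag A * A * invSqrtDiag A - A = E * A + A * E + E * A * E := by
    have : invSqrtDiag A = 1 + E := by rw [hE]; abel
    rw [this]
    noncomm_ring
  have hA := norm_nonneg A
  have hEA : ‖E * A‖ ≤ η * ‖A‖ :=
    (norm_mul_le _ _).trans (mul_le_mul_of_nonneg_right hEn hA)
  have hAE : ‖A * E‖ ≤ η * ‖A‖ :=
    (norm_mul_le _ _).trans ((mul_le_mul_of_nonneg_left hEn hA).trans (le_of_eq (mul_comm _ _)))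
  have hEAE : ‖E * A * E‖ ≤ η * ‖A‖ := by
    refine (norm_mul_le _ _).trans ?_
    calc _ ≤ (η * ‖A‖) * 1 := mul_le_mul hEA (by linarith) (norm_nonneg _) (by positivity)
      _ = _ := mul_one _
  rw [e]
  refine (norm_add₃_le).trans ?_
  linarith

/-- The sample coherency is also the renormalization of `C̃`: the true spectral densities cancel. -/
theorem coherencyHat_eq {Ω : Type*} [MeasurableSpace Ω] {μ : Measure Ω} {y : ℕ → ℤ → Ω → ℂ}
    {N M B : ℕ} {ν : ℝ} (hs : ∀ m, 0 < spectralDensity μ (y m) ν) (ω : Ω) :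
    coherencyHat y N M B ν ω = invSqrtDiag (coherencyTilde μ y N M B ν ω) *
      coherencyTilde μ y N M B ν ω * invSqrtDiag (coherencyTilde μ y N M B ν ω) := by
  have hC : ∀ i j : Fin M, coherencyTilde μ y N M B ν ω i j =
      (((√(spectralDensity μ (y i) ν))⁻¹ : ℝ) : ℂ) * smoothedPeriodogram y N M B ν ω i j *
        (((√(spectralDensity μ (y j) ν))⁻¹ : ℝ) : ℂ) := by
    intro i j
    rw [coherencyTilde, invSqrtDiag, Matrix.mul_diagonal, Matrix.diagonal_mul]
    simp only [spectralMatrix, Matrix.diagonal_apply_eq, Complex.ofReal_re]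
  have hD : ∀ i : Fin M, (√(coherencyTilde μ y N M B ν ω i i).re)⁻¹ =
      √(spectralDensity μ (y i) ν) * (√(smoothedPeriodogram y N M B ν ω i i).re)⁻¹ := by
    intro i
    have h1 : (coherencyTilde μ y N M B ν ω i i).re =
        (smoothedPeriodogram y N M B ν ω i i).re / spectralDensity μ (y i) ν := by
      rw [hC, mul_right_comm, ← Complex.ofReal_mul, ← mul_inv, Real.mul_self_sqrt (hs i).le,
        Complex.re_ofReal_mul]
      ring
    rw [h1, Real.sqrt_div' _ (hs i).le, inv_div]
    rfl
  ext i j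
  rw [coherencyHat, invSqrtDiag, invSqrtDiag, Matrix.mul_diagonal, Matrix.diagonal_mul,
    Matrix.mul_diagonal, Matrix.diagonal_mul, hD i, hD j, hC i j]
  have hi : (√(spectralDensity μ (y i) ν) : ℂ) ≠ 0 := by
    exact_mod_cast (Real.sqrt_pos.2 (hs i)).ne'
  have hj : (√(spectralDensity μ (y j) ν) : ℂ) ≠ 0 := by
    exact_mod_cast (Real.sqrt_pos.2 (hs j)).ne'
  push_cast
  field_simp

/-- The entries of a coherency matrix are at most `1`, by the Cauchy-Schwarz inequality. -/
theorem norm_invSqrtDiag_gram_le {p B : ℕ} (Z : Matrix (Fin p) (Fin (B + 1)) ℂ) :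
    ‖invSqrtDiag (gram Z) * gram Z * invSqrtDiag (gram Z)‖ ≤ p := by
  refine (l2_opNorm_le_of_entry_le _ zero_le_one fun i j => ?_).trans (le_of_eq (mul_one _))
  have hq : (0 : ℝ) < B + 1 := by positivity
  have hdiag : ∀ i, (gram Z i i).re = (∑ k, ‖Z i k‖ ^ 2) / (B + 1) := by
    intro i
    have : gram Z i i = (((∑ k, ‖Z i k‖ ^ 2) / (B + 1) : ℝ) : ℂ) := by
      rw [gram, Matrix.smul_apply, Matrix.mul_apply]
      simp only [Matrix.conjTranspose_apply, RCLike.star_def, Complex.mul_conj', smul_eq_mul]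
      push_cast
      ring
    rw [this, Complex.ofReal_re]
  have hij : ‖gram Z i j‖ ≤ √(gram Z i i).re * √(gram Z j j).re := by
    rw [hdiag, hdiag, gram, Matrix.smul_apply, norm_smul, norm_one_div_add_one, Matrix.mul_apply,
      Real.sqrt_div' _ hq.le, Real.sqrt_div' _ hq.le, div_mul_div_comm, Real.mul_self_sqrt hq.le,
      one_div_mul_eq_div]
    gcongr
    refine le_trans (norm_sum_le_of_le _ fun k _ => ?_)
      (Real.sum_mul_le_sqrt_mul_sqrt Finset.univ (fun k => ‖Z i k‖) fun k => ‖Z j k‖)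
    rw [norm_mul, Matrix.conjTranspose_apply, norm_star]
  rw [invSqrtDiag, Matrix.mul_diagonal, Matrix.diagonal_mul, norm_mul, norm_mul, Complex.norm_real,
    Complex.norm_real, Real.norm_eq_abs, Real.norm_eq_abs,
    abs_of_nonneg (inv_nonneg.2 (Real.sqrt_nonneg _)),
    abs_of_nonneg (inv_nonneg.2 (Real.sqrt_nonneg _))]
  calc _ ≤ (√(gram Z i i).re)⁻¹ * (√(gram Z i i).re * √(gram Z j j).re) *
        (√(gram Z j j).re)⁻¹ := by gcongr
    _ = ((√(gram Z i i).re)⁻¹ * √(gram Z i i).re) * (√(gram Z j j).re * (√(gram Z j j).re)⁻¹) := by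
        ring
    _ ≤ 1 * 1 := by
        refine mul_le_mul inv_mul_le_one mul_inv_le_one (by positivity) zero_le_one
    _ = 1 := one_mul _

theorem HasIndepStdRows.measure_not_isTame_le {Ω : Type*} [MeasurableSpace Ω] {μ : Measure Ω}
    [IsProbabilityMeasure μ] {p B : ℕ} (hp : p ≤ B + 1) {X : Fin p → Fin (B + 1) → Ω → ℂ}
    (h : HasIndepStdRows μ X) {F : Fin p → Matrix (Fin (B + 1)) (Fin (B + 1)) ℂ} {δ τ : ℝ}
    (hδ : 0 < δ) (hδ1 : δ ≤ 1) (hF : ∀ i, ‖F i‖ ≤ δ) (hτ : 8 ≤ τ) :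
    μ.real {ω | ¬ IsTame (Matrix.of fun i k => X i k ω)
      (Matrix.of fun i k => X i k ω + ∑ l, F i k l * X i l ω) δ τ} ≤
      (2 * p + 2) * Real.exp (4 - τ / 10) := by
  have h1 := h.measure_opNorm_le (Nat.le_add_left 1 B) hp (fun _ => 1) one_pos
    (fun _ => l2_opNorm_one_le _) hτ
  have h2 := h.measure_opNorm_le (Nat.le_add_left 1 B) hp F hδ hF hτ
  have h3 := fun i => (h.std i).measure_norm_sq_deviation_le (t := τ) (Nat.le_add_left 1 B)
  simp only [Matrix.one_apply, ite_mul, one_mul, zero_mul, Finset.sum_ite_eq, Finset.mem_univ,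
    if_true, Nat.cast_add, Nat.cast_one] at h1 h2 h3
  set A1 := {ω | τ * √((B : ℝ) + 1) < ‖(Matrix.of fun i k => X i k ω :
    Matrix (Fin p) (Fin (B + 1)) ℂ)‖}
  set A2 := {ω | δ * τ * √((B : ℝ) + 1) < ‖(Matrix.of fun i k => ∑ l, F i k l * X i l ω :
    Matrix (Fin p) (Fin (B + 1)) ℂ)‖}
  set A3 : Fin p → Set Ω := fun i => {ω | τ * √((B : ℝ) + 1) < |∑ k, ‖X i k ω‖ ^ 2 - (B + 1)|}
  have hsub : {ω | ¬ IsTame (Matrix.of fun i k => X i k ω)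
      (Matrix.of fun i k => X i k ω + ∑ l, F i k l * X i l ω) δ τ} ⊆ A1 ∪ A2 ∪ ⋃ i, A3 i := by
    intro ω hω
    by_contra hcon
    simp only [Set.mem_union, Set.mem_iUnion, not_or, not_exists] at hcon
    obtain ⟨⟨c1, c2⟩, c3⟩ := hcon
    exact hω (isTame_of_bounds hδ.le hδ1 (by linarith) (not_lt.1 c1) (not_lt.1 c2)
      fun i => not_lt.1 (c3 i))
  have e1 : Real.exp (4 - τ ^ 2 / 16) ≤ Real.exp (4 - τ / 10) := Real.exp_le_exp.2 (by nlinarith)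
  have e2 : Real.exp (1 / 25 - τ / 10) ≤ Real.exp (4 - τ / 10) := Real.exp_le_exp.2 (by linarith)
  have h3' : μ.real (⋃ i, A3 i) ≤ p * (2 * Real.exp (4 - τ / 10)) := by
    refine (measureReal_iUnion_fintype_le _).trans ?_
    calc _ ≤ ∑ i : Fin p, 2 * Real.exp (4 - τ / 10) :=
          Finset.sum_le_sum fun i _ => (h3 i).trans (by linarith)
      _ = _ := by simp
  refine (measureReal_mono hsub).trans ?_
  have u1 := measureReal_union_le (μ := μ) (A1 ∪ A2) (⋃ i, A3 i)
  have u2 := measureReal_union_le (μ := μ) A1 A2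
  linarith

/-- On the tame event the renormalized matrix is within `O(τ⁶ (1 / √B + B / N))` of the Gaussian
one. When the right-hand side is not small, the crude bound `p ≤ B + 1` on the renormalized matrix
suffices. -/
theorem IsTame.norm_renormalized_sub_le {p B N : ℕ} {X Z : Matrix (Fin p) (Fin (B + 1)) ℂ}
    {L τ : ℝ} (hL : 1 ≤ L) (hτ : 1 ≤ τ) (hp : p ≤ B + 1) (hB : 1 ≤ B) (hN : 0 < N)
    (hNB : 24 * L * τ ^ 2 * (B + 1) ≤ N) (h : IsTame X Z (L * ((B + 1) / N)) τ) :
    ‖invSqrtDiag (gram Z) * gram Z * invSqrtDiag (gram Z) - gram X‖ ≤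
      20000 * L ^ 3 * τ ^ 6 * (1 / √B + B / N) := by
  have hN' : (0 : ℝ) < N := by exact_mod_cast hN
  have hB' : (1 : ℝ) ≤ B := by exact_mod_cast hB
  have hp' : (p : ℝ) ≤ B + 1 := by exact_mod_cast hp
  have hsB : 0 < √(B : ℝ) := by positivity
  set δ := L * (((B : ℝ) + 1) / N) with hδ
  set a := 1 / √(B : ℝ) with ha
  set b := (B : ℝ) / N with hb
  set η := τ / √(B + 1) + 3 * δ * τ ^ 2 with hη
  have ha0 : 0 < a := by positivity
  have hb0 : 0 < b := by positivity
  have hδ0 : 0 < δ := by positivity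
  have hδb : δ ≤ 2 * L * b := by
    have : ((B : ℝ) + 1) / N ≤ 2 * b := by
      rw [hb, ← mul_div_assoc]
      gcongr
      linarith
    calc δ ≤ L * (2 * b) := by rw [hδ]; gcongr
      _ = _ := by ring
  have hτ2 : τ ≤ τ ^ 2 := by nlinarith
  have hL3 : L ≤ L ^ 3 := le_self_pow₀ hL (by norm_num)
  have hτ46 : τ ^ 4 ≤ τ ^ 6 := pow_le_pow_right₀ hτ (by norm_num)
  have hη0 : 0 ≤ η := by positivity
  have hηle : η ≤ 6 * L * τ ^ 2 * (a + b) := by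
    have h1 : τ / √(B + 1) ≤ τ ^ 2 * a := by
      have : 1 / √((B : ℝ) + 1) ≤ a := one_div_le_one_div_of_le hsB (Real.sqrt_le_sqrt (by linarith))
      calc τ / √(B + 1) = τ * (1 / √((B : ℝ) + 1)) := by ring
        _ ≤ τ ^ 2 * a := by gcongr
    have h2 : 3 * δ * τ ^ 2 ≤ 3 * (2 * L * b) * τ ^ 2 := by gcongr
    have h3 : τ ^ 2 * a ≤ 6 * L * (τ ^ 2 * a) := le_mul_of_one_le_left (by positivity) (by linarith)
    calc η ≤ 6 * L * (τ ^ 2 * a) + 3 * (2 * L * b) * τ ^ 2 := by rw [hη]; linarith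
      _ = _ := by ring
  rcases le_or_gt η (1 / 2) with hη2 | hη2
  · have h1 := norm_invSqrtDiag_conj_sub_le (gram Z) hη0 hη2 h.diag_le
    have h2 : 3 * η * ‖gram Z‖ ≤ 3 * η * (4 * τ ^ 2) :=
      mul_le_mul_of_nonneg_left h.norm_gram_le' (by positivity)
    have h3 : 3 * δ * τ ^ 2 ≤ η * τ ^ 2 := by
      have : 3 * δ ≤ 3 * δ * τ ^ 2 := le_mul_of_one_le_right (by positivity) (by nlinarith)
      have h4 : 3 * δ ≤ η := by
        have : 0 ≤ τ / √((B : ℝ) + 1) := by positivity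
        rw [hη]; linarith
      gcongr
    calc _ ≤ ‖invSqrtDiag (gram Z) * gram Z * invSqrtDiag (gram Z) - gram Z‖ +
          ‖gram Z - gram X‖ := norm_sub_le_norm_sub_add_norm_sub _ _ _
      _ ≤ 13 * τ ^ 2 * η := by have := h.norm_sub_le; nlinarith
      _ ≤ 13 * τ ^ 2 * (6 * L * τ ^ 2 * (a + b)) := by gcongr
      _ = 78 * (L * τ ^ 4) * (a + b) := by ring
      _ ≤ 20000 * (L ^ 3 * τ ^ 6) * (a + b) := by gcongr; norm_num
      _ = _ := by ring
  · -- `B / N` is negligible, so that `1 / √B` cannot be small: `B` is at most of order `τ ^ 4`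
    have hb1 : b ≤ 1 / (24 * L * τ ^ 2) := by
      rw [hb, div_le_div_iff₀ hN' (by positivity)]
      nlinarith [show 0 ≤ 24 * L * τ ^ 2 by positivity]
    have ha1 : 1 ≤ 24 * L * τ ^ 2 * a := by
      have h1 : 24 * L * τ ^ 2 * b ≤ 1 := by
        rw [le_div_iff₀ (by positivity)] at hb1; linarith
      nlinarith
    have hab : 1 ≤ 24 * L * τ ^ 2 * (a + b) := by
      have : 0 ≤ 24 * L * τ ^ 2 * b := by positivity
      linarith
    have hBle : (B : ℝ) ≤ (24 * L * τ ^ 2) ^ 2 := by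
      rw [ha, mul_one_div, le_div_iff₀ hsB, one_mul] at ha1
      calc (B : ℝ) = √B ^ 2 := (Real.sq_sqrt (by positivity)).symm
        _ ≤ _ := by gcongr
    have h1 := norm_invSqrtDiag_gram_le Z
    have hone : 1 ≤ L ^ 2 * τ ^ 4 := one_le_mul_of_one_le_of_one_le (one_le_pow₀ hL) (one_le_pow₀ hτ)
    have hLτ : τ ^ 2 ≤ L ^ 2 * τ ^ 4 := by
      have h4 : τ ^ 2 ≤ τ ^ 4 := pow_le_pow_right₀ hτ (by norm_num)
      exact h4.trans (le_mul_of_one_le_left (by positivity) (one_le_pow₀ hL))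
    calc _ ≤ ‖invSqrtDiag (gram Z) * gram Z * invSqrtDiag (gram Z)‖ + ‖gram X‖ := _root_.norm_sub_le _ _
      _ ≤ ((24 * L * τ ^ 2) ^ 2 + 1) + τ ^ 2 := by have := h.norm_gram_le; linarith
      _ ≤ 578 * (L ^ 2 * τ ^ 4) := by nlinarith
      _ ≤ 578 * (L ^ 2 * τ ^ 4) * (24 * L * τ ^ 2 * (a + b)) :=
          le_mul_of_one_le_right (by positivity) hab
      _ = 13872 * (L ^ 3 * τ ^ 6 * (a + b)) := by ring
      _ ≤ 20000 * (L ^ 3 * τ ^ 6 * (a + b)) := by gcongr; norm_num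
      _ = _ := by ring

end

/-! ### Asymptotics -/

section

open scoped Matrix.Norms.L2Operator

theorem measurable_gram {Ω : Type*} [MeasurableSpace Ω] {p B : ℕ}
    {W : Ω → Matrix (Fin p) (Fin (B + 1)) ℂ} (hW : ∀ i k, Measurable fun ω => W ω i k)
    (i j : Fin p) : Measurable fun ω => gram (W ω) i j := by
  simp only [gram, Matrix.smul_apply, Matrix.mul_apply, Matrix.conjTranspose_apply,
    RCLike.star_def, smul_eq_mul]
  have : ∀ i k, Measurable fun ω => conj (W ω i k) := fun i k =>
    Complex.continuous_conj.measurable.comp (hW i k)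
  fun_prop

theorem eventually_const_mul_rpow_le (C : ℝ) {a b : ℝ} (hab : a < b) :
    ∀ᶠ N : ℕ in atTop, C * (N : ℝ) ^ a ≤ (N : ℝ) ^ b := by
  have h1 : Tendsto (fun N : ℕ => (N : ℝ) ^ (b - a)) atTop atTop :=
    (tendsto_rpow_atTop (sub_pos.2 hab)).comp tendsto_natCast_atTop_atTop
  filter_upwards [h1.eventually_ge_atTop C, eventually_gt_atTop 0] with N hN hN0
  have hN0' : (0 : ℝ) < N := by exact_mod_cast hN0
  calc C * (N : ℝ) ^ a ≤ (N : ℝ) ^ (b - a) * (N : ℝ) ^ a := by gcongr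
    _ = (N : ℝ) ^ b := by rw [← Real.rpow_add hN0']; congr 1; ring

/-- The tail `exp (-N ^ e / 10)` absorbs the union bound over the rows and leaves
`exp (-N ^ (e / 2))`. -/
theorem eventually_poly_mul_exp_le {e : ℝ} (he : 0 < e) :
    ∀ᶠ N : ℕ in atTop, (2 * (N : ℝ) + 2) * Real.exp (4 - (N : ℝ) ^ e / 10) ≤
      Real.exp (-(N : ℝ) ^ (e / 2)) := by
  have h1 : Tendsto (fun N : ℕ => (N : ℝ) ^ (e / 2)) atTop atTop :=
    (tendsto_rpow_atTop (half_pos he)).comp tendsto_natCast_atTop_atTop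
  have h2 := ((isLittleO_log_rpow_atTop (half_pos he)).comp_tendsto
    tendsto_natCast_atTop_atTop).bound one_pos
  filter_upwards [h1.eventually_ge_atTop 30, h2, eventually_ge_atTop 1] with N hN hlog hN1
  have hN1' : (1 : ℝ) ≤ N := by exact_mod_cast hN1
  have hsq : (N : ℝ) ^ e = ((N : ℝ) ^ (e / 2)) ^ 2 := by
    rw [← Real.rpow_natCast, ← Real.rpow_mul (by positivity)]
    congr 1
    push_cast
    ring
  set x := (N : ℝ) ^ (e / 2)
  simp only [Function.comp, Real.norm_eq_abs, one_mul] at hlog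
  have hlog' : Real.log N ≤ x := (le_abs_self _).trans (hlog.trans (abs_of_pos (by linarith)).le)
  have hNx : (N : ℝ) ≤ Real.exp x := by
    rw [← Real.exp_log (by linarith : (0 : ℝ) < N)]
    exact Real.exp_le_exp.2 hlog'
  have h4 : (4 : ℝ) ≤ Real.exp 3 := by have := Real.add_one_le_exp (3 : ℝ); linarith
  calc _ ≤ (Real.exp 3 * Real.exp x) * Real.exp (4 - (N : ℝ) ^ e / 10) := by
        gcongr
        nlinarith [Real.exp_pos x]
    _ = Real.exp (3 + x + (4 - x ^ 2 / 10)) := by rw [hsq, Real.exp_add, Real.exp_add]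
    _ ≤ _ := Real.exp_le_exp.2 (by nlinarith)

/-- The asymptotic conditions under which the bounds on the tame event, at the scale `τ = N ^ e`,
give the stochastic domination at the scale `N ^ ε`. -/
theorem exists_eventually_scale {M B : ℕ → ℕ} {α c : ℝ} (hα : 0 < α) (hα' : α < 1)
    (hB : (fun N : ℕ => (B N : ℝ)) =O[atTop] fun N : ℕ => (N : ℝ) ^ α) (hc : 0 < c) (hc' : c < 1)
    (hratio : Tendsto (fun N : ℕ => (M N : ℝ) / ((B N : ℝ) + 1)) atTop (𝓝 c)) {L : ℝ} (hL : 1 ≤ L)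
    (C : ℝ) {ε : ℝ} (hε : 0 < ε) :
    ∃ e : ℝ, 0 < e ∧ ∀ᶠ N : ℕ in atTop, 0 < N ∧ 1 ≤ B N ∧ M N ≤ B N + 1 ∧ 8 ≤ (N : ℝ) ^ e ∧
      24 * L * ((N : ℝ) ^ e) ^ 2 * (B N + 1) ≤ N ∧ C * ((N : ℝ) ^ e) ^ 6 ≤ (N : ℝ) ^ ε ∧
      (2 * (M N : ℝ) + 2) * Real.exp (4 - (N : ℝ) ^ e / 10) ≤ Real.exp (-(N : ℝ) ^ (e / 2)) := by
  -- `6 e < ε` absorbs the factor `τ ^ 6`, and `2 e + α < 1` keeps `τ ^ 2 (B / N)` small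
  set e := min (ε / 7) ((1 - α) / 4) with he
  have he0 : 0 < e := lt_min (by linarith) (by linarith)
  have he1 : e ≤ ε / 7 := min_le_left _ _
  have he2 : e ≤ (1 - α) / 4 := min_le_right _ _
  refine ⟨e, he0, ?_⟩
  obtain ⟨C', hC'⟩ := hB.bound
  have h1 : Tendsto (fun N : ℕ => (N : ℝ) ^ e) atTop atTop :=
    (tendsto_rpow_atTop he0).comp tendsto_natCast_atTop_atTop
  have hpow : ∀ (N : ℕ) (k : ℕ), ((N : ℝ) ^ e) ^ k = (N : ℝ) ^ (k * e) := fun N k => by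
    rw [← Real.rpow_natCast, ← Real.rpow_mul (by positivity), mul_comm]
  filter_upwards [hC', eventually_gt_atTop 0, h1.eventually_ge_atTop 8,
    eventually_poly_mul_exp_le he0,
    eventually_const_mul_rpow_le C (a := (6 : ℕ) * e) (b := ε) (by push_cast; linarith),
    eventually_const_mul_rpow_le (24 * L * (C' + 1)) (a := (2 : ℕ) * e + α) (b := 1)
      (by push_cast; linarith),
    hratio.eventually (Ioo_mem_nhds hc hc')] with N hCN hN h8 hexp h6 h2 hr
  have hN1 : (1 : ℝ) ≤ N := by exact_mod_cast hN
  have hBpos : (0 : ℝ) < B N + 1 := by positivity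
  have hMB : M N < B N + 1 := by
    have := (div_lt_one hBpos).1 hr.2
    exact_mod_cast this
  -- the limit ratio lies strictly between `0` and `1`, which excludes `B N = 0`
  have hM0 : 0 < M N := by
    by_contra h
    have h0 : M N = 0 := by omega
    have := hr.1
    simp [h0] at this
  have hBle : (B N : ℝ) + 1 ≤ (C' + 1) * (N : ℝ) ^ α := by
    have h3 : (B N : ℝ) ≤ C' * (N : ℝ) ^ α := by
      simpa [abs_of_nonneg (Real.rpow_nonneg (by positivity : (0 : ℝ) ≤ N) α)] using hCN
    have h4 : 1 ≤ (N : ℝ) ^ α := Real.one_le_rpow hN1 hα.le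
    linarith
  have h24 : 24 * L * ((N : ℝ) ^ e) ^ 2 * (B N + 1) ≤ N := by
    calc _ ≤ 24 * L * ((N : ℝ) ^ e) ^ 2 * ((C' + 1) * (N : ℝ) ^ α) := by gcongr
      _ = 24 * L * (C' + 1) * (N : ℝ) ^ ((2 : ℕ) * e + α) := by
          rw [hpow, Real.rpow_add (by linarith)]; ring
      _ ≤ N := by rwa [Real.rpow_one] at h2
  have hMN : (M N : ℝ) ≤ N := by
    have h5 : (M N : ℝ) ≤ B N + 1 := by exact_mod_cast hMB.le
    have h7 : 1 ≤ 24 * L * ((N : ℝ) ^ e) ^ 2 :=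
      one_le_mul_of_one_le_of_one_le (by linarith) (one_le_pow₀ (by linarith))
    exact h5.trans ((le_mul_of_one_le_left hBpos.le h7).trans h24)
  refine ⟨hN, by omega, hMB.le, h8, h24, by rwa [hpow], le_trans ?_ hexp⟩
  gcongr

end

end Coherency

end

theorem mainTheorem3 {Ω : Type*} [MeasurableSpace Ω] (μ : Measure Ω) [IsProbabilityMeasure μ]
    -- the `m`-th series (`m ≥ 1` in the usual numbering) is `y (m - 1)`
    (y : ℕ → ℤ → Ω → ℂ)
    (hgauss : ∀ m, Coherency.IsStationaryComplexGaussian μ (y m))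
    (hindep : iIndepFun (fun (m : ℕ) (ω : Ω) (n : ℤ) => y m n ω) μ)
    (M B : ℕ → ℕ) (hBeven : ∀ N, Even (B N))
    (α : ℝ) (hα : 1 / 2 < α) (hα' : α < 1)
    (hB : (fun N : ℕ => (B N : ℝ)) =O[atTop] fun N : ℕ => (N : ℝ) ^ α)
    (hM : (fun N : ℕ => (M N : ℝ)) =O[atTop] fun N : ℕ => (N : ℝ) ^ α)
    (c : ℝ) (hc : 0 < c) (hc' : c < 1)
    (hratio : Tendsto (fun N : ℕ => (M N : ℝ) / ((B N : ℝ) + 1)) atTop (𝓝 c))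
    (hlower : ∃ κ : ℝ, 0 < κ ∧ ∀ m, ∀ ν ∈ Set.Icc (0 : ℝ) 1,
      κ ≤ |Coherency.spectralDensity μ (y m) ν|)
    (γ₀ : ℝ) (hγ₀ : 3 ≤ γ₀)
    (hcov : ∃ K : ℝ, ∀ m,
      Summable (fun u : ℤ => (1 + |(u : ℝ)|) ^ γ₀ * ‖Coherency.autocov μ (y m) u‖) ∧
      ∑' u : ℤ, (1 + |(u : ℝ)|) ^ γ₀ * ‖Coherency.autocov μ (y m) u‖ ≤ K) :
    ∃ (X : (N : ℕ) → Set.Icc (0 : ℝ) 1 → Ω → Matrix (Fin (M N)) (Fin (B N + 1)) ℂ)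
      (Δtilde Δ : (N : ℕ) → Set.Icc (0 : ℝ) 1 → Ω → Matrix (Fin (M N)) (Fin (M N)) ℂ),
      (∀ N ν, Coherency.IsStdComplexGaussianMatrix μ (X N ν)) ∧
      (∀ N ν i j, Measurable (fun ω => Δtilde N ν ω i j)) ∧
      (∀ N ν i j, Measurable (fun ω => Δ N ν ω i j)) ∧
      (∀ N (ν : Set.Icc (0 : ℝ) 1) ω, Coherency.coherencyTilde μ y N (M N) (B N) ν ω =
        (1 / ((B N : ℂ) + 1)) • (X N ν ω * (X N ν ω)ᴴ) + Δtilde N ν ω) ∧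
      Coherency.StochDom μ (U := fun _ => Set.Icc (0 : ℝ) 1)
        (fun N ν ω => Coherency.specNorm (Δtilde N ν ω))
        (fun N _ _ => (B N : ℝ) / N) ∧
      (∀ N (ν : Set.Icc (0 : ℝ) 1) ω, Coherency.coherencyHat y N (M N) (B N) ν ω =
        (1 / ((B N : ℂ) + 1)) • (X N ν ω * (X N ν ω)ᴴ) + Δ N ν ω) ∧
      Coherency.StochDom μ (U := fun _ => Set.Icc (0 : ℝ) 1)
        (fun N ν ω => Coherency.specNorm (Δ N ν ω))
        (fun N _ _ => 1 / Real.sqrt (B N) + (B N : ℝ) / N) := by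
  open Coherency in
  obtain ⟨κ, hκ, hκs⟩ := hlower
  obtain ⟨K, hKc⟩ := hcov
  have hK : ∀ m, WeightedSummable (autocov μ (y m)) K := by
    intro m
    have hle : ∀ u : ℤ, (1 + |(u : ℝ)|) * ‖autocov μ (y m) u‖ ≤
        (1 + |(u : ℝ)|) ^ γ₀ * ‖autocov μ (y m) u‖ := fun u => by
      refine mul_le_mul_of_nonneg_right ?_ (norm_nonneg _)
      exact Real.self_le_rpow_of_one_le (by linarith [abs_nonneg (u : ℝ)]) (by linarith)
    have hsum := (hKc m).1.of_nonneg_of_le (fun u => by positivity) hle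
    exact ⟨hsum, (hsum.tsum_le_tsum hle (hKc m).1).trans (hKc m).2⟩
  have hs : ∀ m, ∀ ν ∈ Set.Icc (0 : ℝ) 1, κ ≤ spectralDensity μ (y m) ν := fun m ν hν => by
    have := hκs m ν hν
    rwa [abs_of_nonneg ((hgauss m).fourierSeries_eq (hK m) ν).1] at this
  have hK0 : 0 ≤ K := (hK 0).nonneg
  set L : ℝ := 8 * K / κ + 1 with hLdef
  have hL : 1 ≤ L := by
    have : 0 ≤ 8 * K / κ := by positivity
    linarith
  have hδle : ∀ N b : ℕ, 8 * K / κ * (((b : ℝ) + 1) / N) ≤ L * (((b : ℝ) + 1) / N) := fun N b =>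
    mul_le_mul_of_nonneg_right (by linarith) (by positivity)
  set Z : (N : ℕ) → Set.Icc (0 : ℝ) 1 → Ω → Matrix (Fin (M N)) (Fin (B N + 1)) ℂ :=
    fun N ν ω => Matrix.of fun i k => normalizedRow μ (y i) N (B N) ν k ω with hZ
  have key : ∀ (N : ℕ) (ν : Set.Icc (0 : ℝ) 1), ∃ X : Fin (M N) → Fin (B N + 1) → Ω → ℂ,
      HasIndepStdRows μ X ∧ (0 < N → M N ≤ B N + 1 → L * (((B N : ℝ) + 1) / N) < 1 →
        ∀ τ : ℝ, 8 ≤ τ → μ.real {ω | ¬ IsTame (Matrix.of fun i k => X i k ω) (Z N ν ω)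
          (L * (((B N : ℝ) + 1) / N)) τ} ≤ (2 * (M N : ℝ) + 2) * Real.exp (4 - τ / 10)) := by
    intro N ν
    by_cases hN : 0 < N ∧ L * (((B N : ℝ) + 1) / N) < 1
    · obtain ⟨hN, hδ1⟩ := hN
      have hN' : (0 : ℝ) < N := by exact_mod_cast hN
      have hBN : B N < N := by
        have h1 : ((B N : ℝ) + 1) / N < 1 :=
          (le_mul_of_one_le_left (by positivity) hL).trans_lt hδ1
        rw [div_lt_one hN'] at h1
        have : B N + 1 < N := by exact_mod_cast h1
        omega
      obtain ⟨X, F, hX, hF, hZX⟩ := exists_hasIndepStdRows hgauss hindep hK hκ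
        (fun m => hs m ν ν.2) (M N) hBN (hδle N (B N)) hδ1
      refine ⟨X, hX, fun _ hMB _ τ hτ => ?_⟩
      have := hX.measure_not_isTame_le hMB (by positivity) hδ1.le hF hτ
      simpa only [hZ, hZX] using this
    · -- no condition on `N` here: a standard matrix is obtained from a window long enough for whitening
      have hlim : Tendsto (fun n : ℕ => L * (((B N : ℝ) + 1) / n)) atTop (𝓝 0) := by
        simpa using (tendsto_const_div_atTop_nhds_zero_nat ((B N : ℝ) + 1)).const_mul L
      obtain ⟨n, hn, hBn⟩ := ((hlim.eventually (gt_mem_nhds one_pos)).and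
        (eventually_gt_atTop (B N))).exists
      obtain ⟨X, F, hX, -, -⟩ := exists_hasIndepStdRows hgauss hindep hK hκ
        (fun m => hs m ν ν.2) (M N) hBn (hδle n (B N)) hn
      exact ⟨X, hX, fun h1 _ h2 => absurd ⟨h1, h2⟩ hN⟩
  choose X hX hXZ using key
  have hCt : ∀ N (ν : Set.Icc (0 : ℝ) 1) ω,
      coherencyTilde μ y N (M N) (B N) ν ω = gram (Z N ν ω) := fun N ν ω =>
    coherencyTilde_eq μ y N (M N) (hBeven N) ν ω
  have hCh : ∀ N (ν : Set.Icc (0 : ℝ) 1) ω, coherencyHat y N (M N) (B N) ν ω =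
      invSqrtDiag (gram (Z N ν ω)) * gram (Z N ν ω) * invSqrtDiag (gram (Z N ν ω)) :=
    fun N ν ω => by
      rw [coherencyHat_eq (μ := μ) (fun m => hκ.trans_le (hs m ν ν.2)), hCt]
  have hXm : ∀ N (ν : Set.Icc (0 : ℝ) 1) i k, Measurable (X N ν i k) := fun N ν i k =>
    ((hX N ν).std i).measurable k
  have hZm : ∀ N (ν : Set.Icc (0 : ℝ) 1) i k, Measurable fun ω => Z N ν ω i k := fun N ν i k =>
    measurable_normalizedRow (hgauss i).measurable N (B N) ν k
  set Xm : (N : ℕ) → Set.Icc (0 : ℝ) 1 → Ω → Matrix (Fin (M N)) (Fin (B N + 1)) ℂ :=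
    fun N ν ω => Matrix.of fun i k => X N ν i k ω with hXmdef
  have hgX : ∀ N ν i j, Measurable fun ω => gram (Xm N ν ω) i j := fun N ν =>
    measurable_gram fun i k => hXm N ν i k
  have hgZ : ∀ N ν i j, Measurable fun ω => gram (Z N ν ω) i j := fun N ν =>
    measurable_gram fun i k => hZm N ν i k
  -- a deterministic bound on the tame event at scale `τ = N ^ e` yields stochastic domination
  have hdom : ∀ (D : (N : ℕ) → Set.Icc (0 : ℝ) 1 → Ω → ℝ) (β : ℕ → ℝ) (C : ℝ),
      (∀ N, 0 ≤ β N) →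
      (∀ N ν ω (τ : ℝ), 1 ≤ τ → 0 < N → 1 ≤ B N → M N ≤ B N + 1 →
        24 * L * τ ^ 2 * (B N + 1) ≤ N →
        IsTame (Xm N ν ω) (Z N ν ω) (L * (((B N : ℝ) + 1) / N)) τ →
        D N ν ω ≤ C * τ ^ 6 * β N) →
      StochDom μ (U := fun _ => Set.Icc (0 : ℝ) 1) D (fun N _ _ => β N) := by
    intro D β C hβ hD ε hε
    obtain ⟨e, he, hev⟩ := exists_eventually_scale (by linarith) hα' hB hc hc' hratio hL C hε
    obtain ⟨N₀, hN₀⟩ := eventually_atTop.1 hev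
    refine ⟨e / 2, half_pos he, N₀, fun N hN ν => ?_⟩
    obtain ⟨hN0, hB1, hMB, h8, h24, hC, hexp⟩ := hN₀ N hN
    have hN0' : (0 : ℝ) < N := by exact_mod_cast hN0
    have hδ1 : L * (((B N : ℝ) + 1) / N) < 1 := by
      rw [← mul_div_assoc, div_lt_one hN0']
      have h1 : (1 : ℝ) ≤ ((N : ℝ) ^ e) ^ 2 := one_le_pow₀ (by linarith)
      have h2 : 0 < L * ((B N : ℝ) + 1) := by positivity
      nlinarith
    refine le_trans (measureReal_mono (fun ω hω => ?_) (measure_ne_top _ _))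
      ((hXZ N ν hN0 hMB hδ1 _ h8).trans hexp)
    intro htame
    have h1 := hD N ν ω _ (by linarith) hN0 hB1 hMB h24 htame
    have h2 := mul_le_mul_of_nonneg_right hC (hβ N)
    have h3 : (N : ℝ) ^ ε * β N < D N ν ω := hω
    exact h3.not_ge (h1.trans h2)
  refine ⟨Xm, fun N ν ω => coherencyTilde μ y N (M N) (B N) ν ω - gram (Xm N ν ω),
    fun N ν ω => coherencyHat y N (M N) (B N) ν ω - gram (Xm N ν ω),
    fun N ν => (hX N ν).isStdComplexGaussianMatrix, fun N ν i j => ?_, fun N ν i j => ?_,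
    fun N ν ω => (add_sub_cancel (gram (Xm N ν ω)) _).symm, ?_,
    fun N ν ω => (add_sub_cancel (gram (Xm N ν ω)) _).symm, ?_⟩
  · simp only [hCt, Matrix.sub_apply]
    exact (hgZ N ν i j).sub (hgX N ν i j)
  · simp only [hCh, Matrix.sub_apply, invSqrtDiag, Matrix.mul_diagonal, Matrix.diagonal_mul]
    have hd : ∀ i, Measurable fun ω => (((√(gram (Z N ν ω) i i).re)⁻¹ : ℝ) : ℂ) := fun i =>
      Complex.measurable_ofReal.comp (Complex.measurable_re.comp (hgZ N ν i i)).sqrt.inv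
    exact (((hd i).mul (hgZ N ν i j)).mul (hd j)).sub (hgX N ν i j)
  · refine hdom _ _ (6 * L) (fun N => by positivity) fun N ν ω τ hτ hN hB1 _ _ htame => ?_
    have hB1' : (1 : ℝ) ≤ B N := by exact_mod_cast hB1
    have hN' : (0 : ℝ) < N := by exact_mod_cast hN
    rw [specNorm_eq_norm]
    beta_reduce
    rw [hCt]
    refine htame.norm_sub_le.trans ?_
    have h1 : ((B N : ℝ) + 1) / N ≤ 2 * (B N / N) := by
      rw [← mul_div_assoc]
      gcongr
      linarith
    have h2 : τ ^ 2 ≤ τ ^ 6 := pow_le_pow_right₀ hτ (by norm_num)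
    calc _ ≤ 3 * (L * (2 * (B N / N))) * τ ^ 6 := by gcongr
      _ = _ := by ring
  · refine hdom _ _ (20000 * L ^ 3) (fun N => by positivity)
      fun N ν ω τ hτ hN hB1 hMB h24 htame => ?_
    rw [specNorm_eq_norm]
    beta_reduce
    rw [hCh]
    exact htame.norm_renormalized_sub_le hL hτ hMB hB1 hN h24
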